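/- Fix an integer $m\ge 1$. For every integer $n\ge 1$, let coupons be drawn one after another, independently, each uniformly distributed over $n$ types. Let $T=T_n$ be the number of coupons drawn until each of the $n$ types has appeared at least $m$ times (which happens almost surely in finite time), and for $k\ge m$ let $S_k$ be the number of $k$-tons, i.e. of types that have appeared exactly $k$ times among the first $T$ coupons. Let $k=k(n)$ be integers with $k\ge m$ such that, as $n\to\infty$, $k=o(\log n)$ if $m=1$, and $k=o\left(\frac{\log n}{\log\log n}\right)$ if $m\ge 2$. Then, as $n\to\infty$, the pair $$\left(\frac{T-n\log n-(m-1)n\log\log n}{n},\ \frac{k!\,S_k}{(\log n)^{k-m+1}}\right)$$ converges jointly in distribution to $(X,e^{-X})$, where $X$ has the Gumbel distribution with location $-\log((m-1)!)$ and scale $1$, i.e. $P(X\le x)=e^{-e^{-(x+\log((m-1)!))}}$ for all $x\in\mathbb{R}$. -/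

import Mathlib

open MeasureTheory ProbabilityTheory Filter Asymptotics

/-- `draw 0, draw 1, …` are independent coupons, each uniformly distributed over `n` types. -/
structure IsCouponSequence {Ω : Type*} [MeasurableSpace Ω] (P : Measure Ω) {n : ℕ}
    (draw : ℕ → Ω → Fin n) : Prop where
  measurable : ∀ i, Measurable (draw i)
  indep : iIndepFun draw P
  uniform : ∀ i c, P.real {ω | draw i ω = c} = 1 / (n : ℝ)

/-- The number of copies of the type `c` among the first `t` coupons of the sequence `x`. -/
def copies {n : ℕ} (x : ℕ → Fin n) (t : ℕ) (c : Fin n) : ℕ :=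
  ((Finset.range t).filter fun i => x i = c).card

/-- The number `T` of coupons drawn until every type has been seen at least `m` times.
(For random uniform coupons such a time exists almost surely; the value is `0` otherwise.) -/
noncomputable def collectionTime {n : ℕ} (m : ℕ) (x : ℕ → Fin n) : ℕ :=
  sInf {t | ∀ c, m ≤ copies x t c}

/-- The number `S_k` of `k`-tons: types seen exactly `k` times among the first `T` coupons. -/
noncomputable def numTons {n : ℕ} (m k : ℕ) (x : ℕ → Fin n) : ℕ :=
  (Finset.univ.filter fun c => copies x (collectionTime m x) c = k).card

/-- `X` has the Gumbel distribution with location `μ` and scale `β`, given by its distribution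
function. -/
def IsGumbel {Ω : Type*} [MeasurableSpace Ω] (P : Measure Ω) (X : Ω → ℝ) (μ β : ℝ) : Prop :=
  AEMeasurable X P ∧
    ∀ x : ℝ, P.real {ω | X ω ≤ x} = Real.exp (-Real.exp (-((x - μ) / β)))

/-!
At a fixed time `t` the law of the numbers of copies of finitely many given types is multinomial, so
the factorial moments of the number of types with a prescribed number of copies are explicit. On the
scale `t = n (log n + d log log n + x + o(1))`, where `m = d + 1`, they show three things.

* The number of types with at most `d` copies has the factorial moments of a Poisson variable of
  mean `e^{-x} / d!` in the limit, so by Bonferroni's inequalities the collection is complete at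
  time `t` with probability tending to `exp (-e^{-x} / d!)`. This is the Gumbel limit of `T`.
* The second moment shows that `k! / (log n)^{k - d}` times the number of types with exactly `k`
  copies is close to `e^{-x}` in probability.
* The occupancy probabilities grow at least geometrically up to `k`, with ratio tending to infinity,
  so on the same scale there are negligibly many types with fewer than `k` copies.

A type with exactly `k` copies at some time has at most `k` copies at every earlier time. When `T`
falls between deterministic times `s ≤ t`, the `k`-tons at time `T` are therefore sandwiched: they
are `k`-tons or rarer at time `s`, and include all `k`-tons of time `t` but some of those that are
rarer at time `s`. Covering the possible values of `T`, which are tight, by finitely many short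
windows gives `k! S_k / (log n)^{k - d} - e^{-Y} → 0` in probability, where `Y` is the centred and
rescaled `T`, and Slutsky's theorem concludes.
-/

open scoped Topology Nat

section Copies

variable {n : ℕ} (x : ℕ → Fin n)

lemma copies_zero (c : Fin n) : copies x 0 c = 0 := by
  simp [copies]

lemma copies_succ (t : ℕ) : copies x (t + 1) = copies x t + Pi.single (x t) 1 := by
  funext c
  by_cases h : x t = c <;>
    simp [copies, Finset.range_add_one, Finset.filter_insert, h, eq_comm (a := c)]

lemma copies_mono : Monotone (copies x) :=
  monotone_nat_of_le_succ fun t => copies_succ x t ▸ le_self_add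

end Copies

namespace IsCouponSequence

variable {Ω : Type*} [MeasurableSpace Ω] {P : Measure Ω} {n : ℕ} {draw : ℕ → Ω → Fin n}

lemma ne_zero (h : IsCouponSequence P draw) : n ≠ 0 := by
  have := h.indep.isProbabilityMeasure
  obtain ⟨ω⟩ := P.nonempty_of_neZero
  exact (draw 0 ω).pos.ne'

lemma measurable_copies (h : IsCouponSequence P draw) (t : ℕ) :
    Measurable fun ω => copies (draw · ω) t := by
  refine measurable_pi_iff.2 fun c => ?_
  simp only [copies, Finset.card_filter]
  exact Finset.measurable_sum _ fun i _ =>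
    Measurable.ite (h.measurable i (measurableSet_singleton c)) measurable_const measurable_const

lemma measurableSet_copies (h : IsCouponSequence P draw) (t : ℕ) (p : (Fin n → ℕ) → Prop) :
    MeasurableSet {ω | p (copies (draw · ω) t)} :=
  h.measurable_copies t (Set.to_countable {v | p v}).measurableSet

lemma indepFun_copies (h : IsCouponSequence P draw) (t : ℕ) :
    IndepFun (fun ω => copies (draw · ω) t) (draw t) P := by
  let count (y : Finset.range t → Fin n) (c : Fin n) : ℕ := ∑ i, if y i = c then 1 else 0
  have hcount (ω : Ω) : copies (draw · ω) t = count fun i => draw i ω := by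
    funext c
    rw [copies, Finset.card_filter]
    exact (Finset.sum_coe_sort (Finset.range t) fun i => if draw i ω = c then 1 else 0).symm
  simp only [hcount]
  exact (h.indep.indepFun_finset (Finset.range t) {t} (by simp) h.measurable).comp
    (ψ := fun y : ({t} : Finset ℕ) → Fin n => y ⟨t, by simp⟩)
    (measurable_of_countable count) (measurable_of_countable _)

lemma measureReal_copies_succ (h : IsCouponSequence P draw) (t : ℕ) (p : (Fin n → ℕ) → Prop) :
    P.real {ω | p (copies (draw · ω) (t + 1))} =
      ∑ c, P.real {ω | p (copies (draw · ω) t + Pi.single c 1)} / n := by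
  have := h.indep.isProbabilityMeasure
  have hcover : {ω | p (copies (draw · ω) (t + 1))} =
      ⋃ c ∈ Finset.univ, {ω | p (copies (draw · ω) t + Pi.single c 1)} ∩ {ω | draw t ω = c} := by
    ext ω
    simp [copies_succ]
  rw [hcover, measureReal_biUnion_finset]
  · refine Finset.sum_congr rfl fun c _ => ?_
    have hindep := (h.indepFun_copies t).measure_inter_preimage_eq_mul
      {v | p (v + Pi.single c 1)} {c} (Set.to_countable _).measurableSet (measurableSet_singleton c)
    rw [div_eq_mul_one_div, ← h.uniform t c]
    simp only [Measure.real, ← ENNReal.toReal_mul]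
    exact congrArg ENNReal.toReal hindep
  · exact fun c _ c' _ hc => Set.disjoint_left.2 fun ω h₁ h₂ => hc (h₁.2.symm.trans h₂.2)
  · exact fun c _ => (h.measurableSet_copies t fun v => p (v + Pi.single c 1)).inter
      (h.measurable t (measurableSet_singleton c))

end IsCouponSequence

section OccupancyProb

variable {κ : Type*}

lemma single_one_le_of_ne_zero [DecidableEq κ] {j : κ → ℕ} {i : κ} (hi : j i ≠ 0) :
    Pi.single i 1 ≤ j :=
  update_le_iff.2 ⟨Nat.pos_of_ne_zero hi, fun _ _ => Nat.zero_le _⟩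

variable [Fintype κ]

/-- The multinomial probability that `κ`-many distinct types, out of `n`, have been seen exactly
`j i` times each after `t` draws. If `∑ i, j i > t`, the value is `0` because of the falling
factorial. -/
noncomputable def occupancyProb (n t : ℕ) (j : κ → ℕ) : ℝ :=
  t.descFactorial (∑ i, j i) / ((∏ i, (j i)! : ℕ) * (n : ℝ) ^ ∑ i, j i) *
    (1 - Fintype.card κ / n) ^ (t - ∑ i, j i)

lemma occupancyProb_zero_left (n : ℕ) (j : κ → ℕ) :
    occupancyProb n 0 j = if j = 0 then 1 else 0 := by
  split_ifs with hj
  · simp [occupancyProb, hj]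
  · obtain ⟨i, hi⟩ := Function.ne_iff.1 hj
    have hpos : 0 < ∑ i, j i :=
      (Nat.pos_of_ne_zero hi).trans_le
        (Finset.single_le_sum (fun _ _ => zero_le) (Finset.mem_univ i))
    simp [occupancyProb, Nat.descFactorial_of_lt hpos]

lemma succ_descFactorial_mul_pow (t J : ℕ) (z : ℝ) :
    (t + 1).descFactorial J * z ^ (t + 1 - J) =
      z * (t.descFactorial J * z ^ (t - J)) +
        J * (t.descFactorial (J - 1) * z ^ (t - (J - 1))) := by
  rcases J with _ | i
  · simp [pow_succ']
  rw [Nat.succ_descFactorial_succ, Nat.add_sub_cancel, Nat.add_sub_add_right]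
  rcases lt_trichotomy i t with hlt | rfl | hgt
  · obtain ⟨u, rfl⟩ : ∃ u, t = i + 1 + u := Nat.exists_eq_add_of_le hlt
    rw [Nat.descFactorial_succ, show i + 1 + u - i = u + 1 by omega,
      show i + 1 + u - (i + 1) = u by omega]
    push_cast
    ring
  · simp
  · simp [Nat.descFactorial_of_lt, hgt]

lemma occupancyProb_sub_single_div [DecidableEq κ] {n : ℕ} (hn : n ≠ 0) (t : ℕ) {j : κ → ℕ} {i : κ}
    (hi : j i ≠ 0) :
    occupancyProb n t (j - Pi.single i 1) / n =
      j i * (t.descFactorial (∑ c, j c - 1) / ((∏ c, (j c)! : ℕ) * (n : ℝ) ^ ∑ c, j c) *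
        (1 - Fintype.card κ / n) ^ (t - (∑ c, j c - 1))) := by
  obtain ⟨v, rfl⟩ : ∃ v : κ → ℕ, j = v + Pi.single i 1 :=
    ⟨_, (tsub_add_cancel_of_le (single_one_le_of_ne_zero hi)).symm⟩
  have hsum : ∑ c, (v + Pi.single i 1 : κ → ℕ) c = ∑ c, v c + 1 := by
    simp [Finset.sum_add_distrib]
  have hprod : ∏ c, ((v + Pi.single i 1 : κ → ℕ) c)! = (v i + 1) * ∏ c, (v c)! := by
    rw [← Finset.mul_prod_erase _ _ (Finset.mem_univ i), ← Finset.mul_prod_erase _ (fun c => (v c)!)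
      (Finset.mem_univ i), ← mul_assoc]
    congr 1
    · simp [Nat.factorial_succ]
    · exact Finset.prod_congr rfl fun c hc => by simp [Finset.ne_of_mem_erase hc]
  rw [add_tsub_cancel_right, hsum, hprod, occupancyProb, Nat.add_sub_cancel]
  simp only [Pi.add_apply, Pi.single_eq_same]
  push_cast
  field_simp
  ring

lemma occupancyProb_succ_left [DecidableEq κ] {n : ℕ} (hn : n ≠ 0) (t : ℕ) (j : κ → ℕ) :
    occupancyProb n (t + 1) j = (1 - Fintype.card κ / n) * occupancyProb n t j +
      ∑ i, if j i = 0 then 0 else occupancyProb n t (j - Pi.single i 1) / n := by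
  have hterm (i : κ) : (if j i = 0 then 0 else occupancyProb n t (j - Pi.single i 1) / n) =
      j i * (t.descFactorial (∑ i, j i - 1) / ((∏ i, (j i)! : ℕ) * (n : ℝ) ^ ∑ i, j i) *
        (1 - Fintype.card κ / n) ^ (t - (∑ i, j i - 1))) := by
    split_ifs with hi
    · simp [hi]
    · exact occupancyProb_sub_single_div hn t hi
  rw [Finset.sum_congr rfl fun i _ => hterm i, ← Finset.sum_mul, occupancyProb, div_mul_eq_mul_div,
    succ_descFactorial_mul_pow, occupancyProb]
  push_cast
  ring

end OccupancyProb

namespace IsCouponSequence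

variable {Ω : Type*} [MeasurableSpace Ω] {P : Measure Ω} {n : ℕ} {draw : ℕ → Ω → Fin n}
  {κ : Type*} [Fintype κ]

lemma measureReal_copies_comp_eq_succ [DecidableEq κ] (h : IsCouponSequence P draw)
    (e : κ ↪ Fin n) (t : ℕ) (j : κ → ℕ) :
    P.real {ω | copies (draw · ω) (t + 1) ∘ e = j} =
      (1 - Fintype.card κ / n) * P.real {ω | copies (draw · ω) t ∘ e = j} +
      ∑ i, if j i = 0 then 0 else
        P.real {ω | copies (draw · ω) t ∘ e = j - Pi.single i 1} / n := by
  have hn : (n : ℝ) ≠ 0 := mod_cast h.ne_zero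
  have hmem (i : κ) : P.real {ω | (copies (draw · ω) t + Pi.single (e i) 1) ∘ e = j} / n =
      if j i = 0 then 0 else P.real {ω | copies (draw · ω) t ∘ e = j - Pi.single i 1} / n := by
    have hcomp (v : Fin n → ℕ) : (v + Pi.single (e i) 1) ∘ e = v ∘ e + Pi.single i 1 :=
      funext fun i' => by simp [Pi.single_apply]
    split_ifs with hi
    · have hne (v : κ → ℕ) : v + Pi.single i 1 ≠ j := fun hv => by simp [← hv] at hi
      simp [hcomp, hne]
    · have hle : Pi.single i 1 ≤ j := single_one_le_of_ne_zero hi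
      simp only [hcomp, eq_tsub_iff_add_eq_of_le hle]
  have hnotMem (c : Fin n) (hc : c ∈ (Finset.univ.map e)ᶜ) :
      P.real {ω | (copies (draw · ω) t + Pi.single c 1) ∘ e = j} / n =
        P.real {ω | copies (draw · ω) t ∘ e = j} / n := by
    have hne (i : κ) : e i ≠ c := fun hi => by simp [← hi] at hc
    have hcomp (v : Fin n → ℕ) : (v + Pi.single c 1) ∘ e = v ∘ e :=
      funext fun i => by simp [hne]
    simp only [hcomp]
  have hcard : (((Finset.univ.map e)ᶜ.card : ℕ) : ℝ) = n - Fintype.card κ := by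
    rw [Finset.card_compl, Finset.card_map, Finset.card_univ, Fintype.card_fin,
      Nat.cast_sub (by simpa using Fintype.card_le_of_embedding e)]
  rw [h.measureReal_copies_succ t fun v => v ∘ e = j,
    ← Finset.sum_add_sum_compl (Finset.univ.map e), Finset.sum_map, add_comm,
    Finset.sum_congr rfl fun i _ => hmem i, Finset.sum_congr rfl hnotMem, Finset.sum_const,
    nsmul_eq_mul, hcard]
  field_simp

lemma measureReal_copies_comp_eq (h : IsCouponSequence P draw) (e : κ ↪ Fin n) (t : ℕ)
    (j : κ → ℕ) :
    P.real {ω | copies (draw · ω) t ∘ e = j} = occupancyProb n t j := by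
  classical
  have := h.indep.isProbabilityMeasure
  induction t generalizing j with
  | zero =>
    have hzero (ω : Ω) : copies (draw · ω) 0 ∘ e = 0 := funext fun i => copies_zero _ _
    rw [occupancyProb_zero_left]
    split_ifs with hj
    · simp [hzero, hj]
    · simp [hzero, Ne.symm hj]
  | succ t ih =>
    simp only [h.measureReal_copies_comp_eq_succ, occupancyProb_succ_left h.ne_zero, ih]

lemma measureReal_copies_lt [DecidableEq κ] (h : IsCouponSequence P draw) (e : κ ↪ Fin n)
    (t m : ℕ) :
    P.real {ω | ∀ i, copies (draw · ω) t (e i) < m} =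
      ∑ j : κ → Fin m, occupancyProb n t fun i => (j i : ℕ) := by
  have := h.indep.isProbabilityMeasure
  have hcover : {ω | ∀ i, copies (draw · ω) t (e i) < m} =
      ⋃ j ∈ (Finset.univ : Finset (κ → Fin m)),
        {ω | copies (draw · ω) t ∘ e = fun i => (j i : ℕ)} := by
    ext ω
    simp only [Set.mem_ofPred_eq, Finset.mem_univ, Set.iUnion_true, Set.mem_iUnion]
    exact ⟨fun hω => ⟨fun i => ⟨_, hω i⟩, rfl⟩,
      fun ⟨j, hj⟩ i => (congrFun hj i).trans_lt (j i).isLt⟩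
  rw [hcover, measureReal_biUnion_finset]
  · simp only [h.measureReal_copies_comp_eq]
  · exact fun j _ j' _ hjj => Set.disjoint_left.2 fun ω h₁ h₂ =>
      hjj (funext fun i => Fin.ext (congrFun (h₁.symm.trans h₂) i))
  · exact fun j _ => h.measurableSet_copies t fun v => v ∘ e = fun i => (j i : ℕ)

end IsCouponSequence

section CountingEvents

variable {Ω ι : Type*} {p : Ω → ι → Prop}

lemma choose_card_filter_eq_sum_indicator [Fintype ι] [∀ ω, DecidablePred (p ω)] (r : ℕ)
    (ω : Ω) :
    ((Finset.univ.filter (p ω)).card.choose r : ℝ) =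
      ∑ s ∈ Finset.powersetCard r Finset.univ, {ω | ∀ c ∈ s, p ω c}.indicator 1 ω := by
  classical
  have hfilter : (Finset.univ.filter (p ω)).powersetCard r =
      (Finset.powersetCard r Finset.univ).filter fun s => ∀ c ∈ s, p ω c := by
    ext s
    simp [Finset.mem_powersetCard, Finset.subset_iff, and_comm]
  rw [← Finset.card_powersetCard, hfilter]
  simp [Set.indicator_apply]

variable [MeasurableSpace Ω]

lemma measurableSet_forall_mem (hp : ∀ c, MeasurableSet {ω | p ω c}) (s : Finset ι) :
    MeasurableSet {ω | ∀ c ∈ s, p ω c} := by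
  simpa only [Set.ofPred_forall] using s.measurableSet_biInter fun c _ => hp c

variable {P : Measure Ω} [IsFiniteMeasure P] [Fintype ι] [∀ ω, DecidablePred (p ω)]

lemma integrable_choose_card_filter (hp : ∀ c, MeasurableSet {ω | p ω c}) (r : ℕ) :
    Integrable (fun ω => ((Finset.univ.filter (p ω)).card.choose r : ℝ)) P := by
  simp only [choose_card_filter_eq_sum_indicator]
  exact integrable_finsetSum _ fun s _ =>
    (integrable_const 1).indicator (measurableSet_forall_mem hp s)

lemma integral_choose_card_filter (hp : ∀ c, MeasurableSet {ω | p ω c}) (r : ℕ) :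
    ∫ ω, ((Finset.univ.filter (p ω)).card.choose r : ℝ) ∂P =
      ∑ s ∈ Finset.powersetCard r Finset.univ, P.real {ω | ∀ c ∈ s, p ω c} := by
  simp only [choose_card_filter_eq_sum_indicator]
  rw [integral_finsetSum _ fun s _ =>
    (integrable_const 1).indicator (measurableSet_forall_mem hp s)]
  exact Finset.sum_congr rfl fun s _ => integral_indicator_one (measurableSet_forall_mem hp s)

lemma integral_choose_card_filter_of_forall_embedding (hp : ∀ c, MeasurableSet {ω | p ω c}) {r : ℕ}
    {v : ℝ} (hv : ∀ e : Fin r ↪ ι, P.real {ω | ∀ i, p ω (e i)} = v) :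
    ∫ ω, ((Finset.univ.filter (p ω)).card.choose r : ℝ) ∂P = (Fintype.card ι).choose r * v := by
  have hterm (s : Finset ι) (hs : s ∈ Finset.powersetCard r Finset.univ) :
      P.real {ω | ∀ c ∈ s, p ω c} = v := by
    let e := s.equivFinOfCardEq (Finset.mem_powersetCard.1 hs).2
    rw [← hv (e.symm.toEmbedding.trans (Function.Embedding.subtype _))]
    congr 1 with ω
    exact ⟨fun h i => h _ (e.symm i).2, fun h c hc => by simpa using h (e ⟨c, hc⟩)⟩
  rw [integral_choose_card_filter hp, Finset.sum_congr rfl hterm, Finset.sum_const,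
    Finset.card_powersetCard, Finset.card_univ, nsmul_eq_mul]

end CountingEvents

lemma abs_indicator_sub_alternating_sum_range_choose_le (N R : ℕ) :
    |({0} : Set ℕ).indicator 1 N - ∑ r ∈ Finset.range R, (-1) ^ r * (N.choose r : ℝ)| ≤
      N.choose R := by
  rcases R with _ | R
  · by_cases hN : N = 0 <;> simp [hN]
  rcases N with _ | N
  · simp [Finset.sum_range_succ']
  have hsum : ∑ r ∈ Finset.range (R + 1), (-1) ^ r * ((N + 1).choose r : ℝ) =
      (-1) ^ R * N.choose R := mod_cast Int.alternating_sum_range_choose_eq_choose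
  rw [hsum, Set.indicator_of_notMem (by simp), zero_sub, abs_neg, abs_mul, abs_pow, abs_neg,
    abs_one, one_pow, one_mul, Nat.abs_cast, Nat.choose_succ_succ]
  exact_mod_cast Nat.le_add_right _ _

section FactorialMoments

variable {Ω : Type*} [MeasurableSpace Ω] {P : Measure Ω} {N : Ω → ℕ}

lemma abs_measureReal_eq_zero_sub_sum_le [IsFiniteMeasure P] (hN : Measurable N)
    (hint : ∀ r, Integrable (fun ω => ((N ω).choose r : ℝ)) P) (R : ℕ) :
    |P.real {ω | N ω = 0} - ∑ r ∈ Finset.range R, (-1) ^ r * ∫ ω, ((N ω).choose r : ℝ) ∂P| ≤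
      ∫ ω, ((N ω).choose R : ℝ) ∂P := by
  have hzero : MeasurableSet {ω | N ω = 0} := hN (measurableSet_singleton 0)
  have hindicator : Integrable ({ω | N ω = 0}.indicator 1) P :=
    (integrable_const (1 : ℝ)).indicator hzero
  have hterm (r : ℕ) : Integrable (fun ω => (-1) ^ r * ((N ω).choose r : ℝ)) P :=
    (hint r).const_mul _
  simp only [← integral_indicator_one hzero, ← integral_const_mul]
  rw [← integral_finsetSum _ fun r _ => hterm r,
    ← integral_sub hindicator (integrable_finsetSum _ fun r _ => hterm r)]
  exact abs_integral_le_integral_abs.trans <| integral_mono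
    (hindicator.sub (integrable_finsetSum _ fun r _ => hterm r)).abs (hint R)
    fun ω => abs_indicator_sub_alternating_sum_range_choose_le (N ω) R

lemma mul_natCast_sub_sq (a y : ℝ) (N : ℕ) : (a * N - y) ^ 2 =
    2 * a ^ 2 * (N.choose 2 : ℝ) + (a - 2 * y) * a * (N.choose 1 : ℝ) + y ^ 2 := by
  rw [Nat.cast_choose_two, Nat.choose_one_right]
  ring

lemma integrable_mul_natCast_sub_sq [IsFiniteMeasure P]
    (hint : ∀ r, Integrable (fun ω => ((N ω).choose r : ℝ)) P) (a y : ℝ) :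
    Integrable (fun ω => (a * N ω - y) ^ 2) P := by
  simp only [mul_natCast_sub_sq]
  exact (((hint 2).const_mul _).add ((hint 1).const_mul _)).add (integrable_const _)

lemma integral_mul_natCast_sub_sq [IsProbabilityMeasure P]
    (hint : ∀ r, Integrable (fun ω => ((N ω).choose r : ℝ)) P) (a y : ℝ) :
    ∫ ω, (a * N ω - y) ^ 2 ∂P = 2 * (a ^ 2 * ∫ ω, ((N ω).choose 2 : ℝ) ∂P) +
      (a - 2 * y) * (a * ∫ ω, ((N ω).choose 1 : ℝ) ∂P) + y ^ 2 := by
  have hpairs := (hint 2).const_mul (2 * a ^ 2)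
  have hmean := (hint 1).const_mul ((a - 2 * y) * a)
  simp only [mul_natCast_sub_sq]
  rw [integral_add (by exact hpairs.add hmean) (integrable_const _), integral_add hpairs hmean,
    integral_const_mul, integral_const_mul, integral_const, probReal_univ, one_smul]
  ring

end FactorialMoments

section FactorialMomentLimits

variable {ι : Type*} {l : Filter ι} {Ω : ι → Type*} [∀ i, MeasurableSpace (Ω i)]
  {P : ∀ i, Measure (Ω i)} [∀ i, IsProbabilityMeasure (P i)] {N : ∀ i, Ω i → ℕ}

lemma tendsto_measureReal_eq_zero_of_factorial_moments (hN : ∀ i, Measurable (N i))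
    (hint : ∀ i r, Integrable (fun ω => ((N i ω).choose r : ℝ)) (P i)) {x : ℝ}
    (hmoments : ∀ r, Tendsto (fun i => ∫ ω, ((N i ω).choose r : ℝ) ∂P i) l (𝓝 (x ^ r / r !))) :
    Tendsto (fun i => (P i).real {ω | N i ω = 0}) l (𝓝 (Real.exp (-x))) := by
  have hexp : Tendsto (fun R => ∑ r ∈ Finset.range R, (-1) ^ r * (x ^ r / r !)) atTop
      (𝓝 (Real.exp (-x))) := by
    rw [Real.exp_eq_exp_ℝ]
    refine (NormedSpace.expSeries_div_hasSum_exp (-x)).tendsto_sum_nat.congr fun R => ?_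
    simp only [neg_pow x, mul_div_assoc]
  have hsum (R : ℕ) : Tendsto
      (fun i => ∑ r ∈ Finset.range R, (-1) ^ r * ∫ ω, ((N i ω).choose r : ℝ) ∂P i) l
      (𝓝 (∑ r ∈ Finset.range R, (-1) ^ r * (x ^ r / r !))) :=
    tendsto_finsetSum _ fun r _ => (hmoments r).const_mul _
  refine Metric.tendsto_nhds.2 fun ε hε => ?_
  obtain ⟨R, hR, hxR⟩ := ((Metric.tendsto_nhds.1 hexp (ε / 3) (by positivity)).and
    ((FloorSemiring.tendsto_pow_div_factorial_atTop x).eventually_lt_const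
      (show 0 < ε / 3 by positivity))).exists
  filter_upwards [Metric.tendsto_nhds.1 (hsum R) (ε / 3) (by positivity),
    (hmoments R).eventually_lt_const hxR] with i hi hRi
  have hbonferroni := abs_measureReal_eq_zero_sub_sum_le (hN i) (hint i) R
  rw [Real.dist_eq] at *
  rw [abs_lt] at *
  rw [abs_le] at hbonferroni
  constructor <;> linarith

lemma tendsto_measureReal_le_abs_sub_of_factorial_moments
    (hint : ∀ i r, Integrable (fun ω => ((N i ω).choose r : ℝ)) (P i)) {a : ι → ℝ} {y : ℝ}
    (ha : Tendsto a l (𝓝 0))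
    (hmean : Tendsto (fun i => a i * ∫ ω, ((N i ω).choose 1 : ℝ) ∂P i) l (𝓝 y))
    (hpairs : Tendsto (fun i => a i ^ 2 * ∫ ω, ((N i ω).choose 2 : ℝ) ∂P i) l (𝓝 (y ^ 2 / 2)))
    {δ : ℝ} (hδ : 0 < δ) :
    Tendsto (fun i => (P i).real {ω | δ ≤ |a i * N i ω - y|}) l (𝓝 0) := by
  have hvariance : Tendsto (fun i => ∫ ω, (a i * N i ω - y) ^ 2 ∂P i) l (𝓝 0) := by
    simp only [fun i => integral_mul_natCast_sub_sq (hint i) (a i) y]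
    have hlim := ((hpairs.const_mul 2).add ((ha.sub_const (2 * y)).mul hmean)).add_const (y ^ 2)
    rwa [show 2 * (y ^ 2 / 2) + (0 - 2 * y) * y + y ^ 2 = 0 by ring] at hlim
  have hmarkov (i : ι) : (P i).real {ω | δ ≤ |a i * N i ω - y|} ≤
      (∫ ω, (a i * N i ω - y) ^ 2 ∂P i) / δ ^ 2 := by
    rw [le_div_iff₀' (by positivity)]
    have hsubset : {ω | δ ≤ |a i * N i ω - y|} = {ω | δ ^ 2 ≤ (a i * N i ω - y) ^ 2} := by
      ext ω
      rw [Set.mem_ofPred_eq, Set.mem_ofPred_eq, ← sq_abs (a i * N i ω - y),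
        sq_le_sq₀ hδ.le (abs_nonneg _)]
    rw [hsubset]
    exact mul_meas_ge_le_integral_of_nonneg (.of_forall fun ω => sq_nonneg _)
      (integrable_mul_natCast_sub_sq (hint i) (a i) y) _
  refine squeeze_zero (fun i => measureReal_nonneg) hmarkov ?_
  simpa using hvariance.div_const (δ ^ 2)

end FactorialMomentLimits

section PowerLimits

variable {ι : Type*} {l : Filter ι}

lemma tendsto_one_add_pow_mul_exp {t : ι → ℕ} {u : ι → ℝ} (hu : Tendsto u l (𝓝 0))
    (htu : Tendsto (fun i => t i * u i ^ 2) l (𝓝 0)) :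
    Tendsto (fun i => (1 + u i) ^ t i * Real.exp (-(t i * u i))) l (𝓝 1) := by
  have hfactor (i : ι) : (1 + u i) ^ t i * Real.exp (-(t i * u i)) =
      ((1 + u i) * Real.exp (-u i)) ^ t i := by
    rw [mul_pow, ← Real.exp_nat_mul, mul_neg]
  have hsmall : ∀ᶠ i in l, |u i| < 1 := by
    simpa using hu.eventually (Metric.ball_mem_nhds (0 : ℝ) one_pos)
  simp only [hfactor]
  refine tendsto_of_tendsto_of_tendsto_of_le_of_le' (by simpa using htu.const_sub 1)
    tendsto_const_nhds ?_ ?_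
  · filter_upwards [hsmall] with i hi
    obtain ⟨hi₁, hi₂⟩ := abs_lt.1 hi
    calc 1 - t i * u i ^ 2 = 1 + t i * -u i ^ 2 := by ring
      _ ≤ (1 + -u i ^ 2) ^ t i := one_add_mul_le_pow (by nlinarith) _
      _ = ((1 + u i) * (-u i + 1)) ^ t i := by ring
      _ ≤ ((1 + u i) * Real.exp (-u i)) ^ t i :=
        pow_le_pow_left₀ (by nlinarith)
          (mul_le_mul_of_nonneg_left (Real.add_one_le_exp _) (by linarith)) _
  · filter_upwards [hsmall] with i hi
    have hpos : 0 ≤ 1 + u i := by linarith [(abs_lt.1 hi).1]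
    refine pow_le_one₀ (by positivity) ?_
    calc (1 + u i) * Real.exp (-u i) ≤ Real.exp (u i) * Real.exp (-u i) := by
          gcongr
          linarith [Real.add_one_le_exp (u i)]
      _ = 1 := by rw [← Real.exp_add, add_neg_cancel, Real.exp_zero]

lemma tendsto_one_add_pow_one {t : ι → ℕ} {u : ι → ℝ} (hu : Tendsto u l (𝓝 0))
    (htu : Tendsto (fun i => t i * u i) l (𝓝 0)) :
    Tendsto (fun i => (1 + u i) ^ t i) l (𝓝 1) := by
  have hsq : Tendsto (fun i => t i * u i ^ 2) l (𝓝 0) := by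
    simpa only [sq, mul_assoc, mul_zero] using htu.mul hu
  have hexp : Tendsto (fun i => Real.exp (t i * u i)) l (𝓝 1) := by
    simpa using htu.rexp
  simpa [mul_assoc, ← Real.exp_add] using (tendsto_one_add_pow_mul_exp hu hsq).mul hexp

lemma tendsto_descFactorial_div_pow {t J : ι → ℕ}
    (hJ : Tendsto (fun i => (J i : ℝ) / t i) l (𝓝 0))
    (hJsq : Tendsto (fun i => (J i : ℝ) ^ 2 / t i) l (𝓝 0)) (ht : ∀ᶠ i in l, t i ≠ 0) :
    Tendsto (fun i => ((t i).descFactorial (J i) : ℝ) / (t i : ℝ) ^ J i) l (𝓝 1) := by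
  have hlower : Tendsto (fun i => (1 + -((J i : ℝ) / t i)) ^ J i) l (𝓝 1) := by
    refine tendsto_one_add_pow_one (by simpa using hJ.neg) ?_
    simpa [sq, mul_div_assoc] using hJsq.neg
  refine tendsto_of_tendsto_of_tendsto_of_le_of_le' hlower tendsto_const_nhds ?_
    (.of_forall fun i => div_le_one_of_le₀ (mod_cast Nat.descFactorial_le_pow _ _) (by positivity))
  filter_upwards [hJ.eventually_lt_const one_pos, ht] with i hi hti
  have hpos : (0 : ℝ) < t i := mod_cast Nat.pos_of_ne_zero hti
  have hle : J i ≤ t i := by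
    rw [div_lt_one hpos] at hi
    exact_mod_cast hi.le
  have hnat : (t i - J i) ^ J i ≤ (t i).descFactorial (J i) :=
    (Nat.pow_le_pow_left (Nat.sub_le_sub_right (Nat.le_succ _) _) _).trans
      (Nat.pow_sub_le_descFactorial _ _)
  rw [← sub_eq_add_neg, one_sub_div hpos.ne', div_pow, ← Nat.cast_sub hle]
  gcongr
  exact_mod_cast hnat

lemma tendsto_choose_div_pow {n : ι → ℕ} (hn : Tendsto n l atTop) (r : ℕ) :
    Tendsto (fun i => ((n i).choose r : ℝ) / (n i : ℝ) ^ r) l (𝓝 (1 / r !)) := by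
  have hn' : Tendsto (fun i => (n i : ℝ)) l atTop := tendsto_natCast_atTop_atTop.comp hn
  have hdesc := tendsto_descFactorial_div_pow (J := fun _ => r) (tendsto_const_nhds.div_atTop hn')
    (tendsto_const_nhds.div_atTop hn') (hn.eventually_ne_atTop 0)
  refine (hdesc.div_const (r ! : ℝ)).congr fun i => ?_
  rw [Nat.descFactorial_eq_factorial_mul_choose]
  push_cast
  field_simp

end PowerLimits

/-- The time `t`, centred and rescaled as the completion time of a collection of `d + 1` copies of
each of `n` types is. -/
noncomputable def centredTime (n d t : ℕ) : ℝ :=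
  t / n - Real.log n - d * Real.log (Real.log n)

/-- The time `t` is `n (log n + d log log n + x + o(1))`, the scale on which the last of `n` types
is seen for the `d + 1`-st time. -/
def IsCollectionScale {ι : Type*} (l : Filter ι) (n : ι → ℕ) (d : ℕ) (t : ι → ℕ) (x : ℝ) : Prop :=
  Tendsto (fun i => centredTime (n i) d (t i)) l (𝓝 x)

/-- The growth condition on a number `k` of copies: `k = o(log n)` if `d = 0`, and
`k = o(log n / log log n)` if `d ≥ 1`. -/
def IsSmallMultiplicity {ι : Type*} (l : Filter ι) (n : ι → ℕ) (d : ℕ) (k : ι → ℕ) : Prop :=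
  Tendsto (fun i => k i * (1 + d * Real.log (Real.log (n i))) / Real.log (n i)) l (𝓝 0)

section Scales

variable {ι : Type*} {l : Filter ι} {n : ι → ℕ}

lemma tendsto_log_natCast (hn : Tendsto n l atTop) :
    Tendsto (fun i => Real.log (n i)) l atTop :=
  Real.tendsto_log_atTop.comp (tendsto_natCast_atTop_atTop.comp hn)

lemma tendsto_log_log_natCast (hn : Tendsto n l atTop) :
    Tendsto (fun i => Real.log (Real.log (n i))) l atTop :=
  Real.tendsto_log_atTop.comp (tendsto_log_natCast hn)

lemma tendsto_log_div_natCast (hn : Tendsto n l atTop) :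
    Tendsto (fun i => Real.log (n i) / n i) l (𝓝 0) :=
  Real.isLittleO_log_id_atTop.tendsto_div_nhds_zero.comp (tendsto_natCast_atTop_atTop.comp hn)

lemma isSmallMultiplicity_const (hn : Tendsto n l atTop) (d j : ℕ) :
    IsSmallMultiplicity l n d fun _ => j := by
  have hlog := tendsto_log_natCast hn
  have hone : Tendsto (fun i => 1 / Real.log (n i)) l (𝓝 0) := tendsto_const_nhds.div_atTop hlog
  have hloglog : Tendsto (fun i => Real.log (Real.log (n i)) / Real.log (n i)) l (𝓝 0) :=
    Real.isLittleO_log_id_atTop.tendsto_div_nhds_zero.comp hlog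
  have hsum := (hone.add (hloglog.const_mul (d : ℝ))).const_mul (j : ℝ)
  rw [mul_zero, add_zero, mul_zero] at hsum
  exact hsum.congr fun i => by ring

namespace IsSmallMultiplicity

variable {d : ℕ} {k : ι → ℕ}

lemma const_mul (hk : IsSmallMultiplicity l n d k) (r : ℕ) :
    IsSmallMultiplicity l n d fun i => r * k i := by
  have hmul := Tendsto.const_mul (r : ℝ) hk
  rw [mul_zero] at hmul
  refine hmul.congr fun i => ?_
  push_cast
  ring

lemma tendsto_div_log (hk : IsSmallMultiplicity l n d k) (hn : Tendsto n l atTop) :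
    Tendsto (fun i => k i / Real.log (n i)) l (𝓝 0) := by
  refine squeeze_zero' ?_ ?_ hk
  · filter_upwards [(tendsto_log_natCast hn).eventually_ge_atTop 0] with i _
    positivity
  · filter_upwards [(tendsto_log_natCast hn).eventually_ge_atTop 0,
      (tendsto_log_log_natCast hn).eventually_ge_atTop 0] with i _ hloglog
    gcongr
    exact le_mul_of_one_le_right (by positivity) (le_add_of_nonneg_right (by positivity))

lemma tendsto_mul_log_log_div_log (hk : IsSmallMultiplicity l n d k) (hn : Tendsto n l atTop) :
    Tendsto (fun i => k i * (d * Real.log (Real.log (n i))) / Real.log (n i)) l (𝓝 0) := by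
  have hsub := Tendsto.sub hk (hk.tendsto_div_log hn)
  rw [sub_zero] at hsub
  exact hsub.congr fun i => by ring

lemma tendsto_div_natCast (hk : IsSmallMultiplicity l n d k) (hn : Tendsto n l atTop) :
    Tendsto (fun i => (k i : ℝ) / n i) l (𝓝 0) := by
  have hmul := (hk.tendsto_div_log hn).mul (tendsto_log_div_natCast hn)
  rw [mul_zero] at hmul
  refine hmul.congr' ?_
  filter_upwards [(tendsto_log_natCast hn).eventually_ne_atTop 0] with i hi
  field_simp

end IsSmallMultiplicity

namespace IsCollectionScale

variable {d : ℕ} {t : ι → ℕ} {x : ℝ}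

lemma tendsto_mul_div_mul_log_sub_one (ht : IsCollectionScale l n d t x) (hn : Tendsto n l atTop)
    {k : ι → ℕ} (hk : IsSmallMultiplicity l n d k) :
    Tendsto (fun i => k i * ((t i : ℝ) / (n i * Real.log (n i)) - 1)) l (𝓝 0) := by
  have hsum := ((hk.tendsto_div_log hn).mul ht).add (hk.tendsto_mul_log_log_div_log hn)
  rw [zero_mul, add_zero] at hsum
  refine hsum.congr' ?_
  filter_upwards [hn.eventually_ne_atTop 0, (tendsto_log_natCast hn).eventually_ne_atTop 0]
    with i hni hlog
  have hni' : (n i : ℝ) ≠ 0 := mod_cast hni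
  rw [centredTime]
  field_simp
  ring

lemma tendsto_div_mul_log_sub_one (ht : IsCollectionScale l n d t x) (hn : Tendsto n l atTop) :
    Tendsto (fun i => (t i : ℝ) / (n i * Real.log (n i)) - 1) l (𝓝 0) := by
  simpa using ht.tendsto_mul_div_mul_log_sub_one hn (isSmallMultiplicity_const hn d 1)

lemma tendsto_div_mul_log (ht : IsCollectionScale l n d t x) (hn : Tendsto n l atTop) :
    Tendsto (fun i => (t i : ℝ) / (n i * Real.log (n i))) l (𝓝 1) := by
  simpa using (ht.tendsto_div_mul_log_sub_one hn).add_const 1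

lemma eventually_ne_zero (ht : IsCollectionScale l n d t x) (hn : Tendsto n l atTop) :
    ∀ᶠ i in l, t i ≠ 0 := by
  filter_upwards [(ht.tendsto_div_mul_log hn).eventually_ne one_ne_zero] with i hi h0
  simp [h0] at hi

lemma tendsto_natCast_div (ht : IsCollectionScale l n d t x) (hn : Tendsto n l atTop) :
    Tendsto (fun i => (n i : ℝ) / t i) l (𝓝 0) := by
  have hmul := (tendsto_log_natCast hn).inv_tendsto_atTop.mul
    ((ht.tendsto_div_mul_log hn).inv₀ one_ne_zero)
  rw [zero_mul] at hmul
  refine hmul.congr' ?_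
  filter_upwards [(tendsto_log_natCast hn).eventually_ne_atTop 0] with i hi
  rw [Pi.inv_apply, inv_div]
  field_simp

lemma tendsto_mul_natCast_div (ht : IsCollectionScale l n d t x) (hn : Tendsto n l atTop)
    {k : ι → ℕ} (hk : IsSmallMultiplicity l n d k) :
    Tendsto (fun i => (k i : ℝ) * n i / t i) l (𝓝 0) := by
  have hmul := (hk.tendsto_div_log hn).mul ((ht.tendsto_div_mul_log hn).inv₀ one_ne_zero)
  rw [zero_mul] at hmul
  refine hmul.congr' ?_
  filter_upwards [(tendsto_log_natCast hn).eventually_ne_atTop 0] with i hi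
  rw [inv_div]
  field_simp

lemma eventually_le (ht : IsCollectionScale l n d t x) (hn : Tendsto n l atTop)
    {k : ι → ℕ} (hk : IsSmallMultiplicity l n d k) : ∀ᶠ i in l, k i ≤ t i := by
  filter_upwards [hn.eventually_ne_atTop 0, ht.eventually_ne_zero hn,
    (ht.tendsto_mul_natCast_div hn hk).eventually_lt_const one_pos] with i hni hti hkt
  rw [div_lt_one (mod_cast Nat.pos_of_ne_zero hti)] at hkt
  exact (Nat.le_mul_of_pos_right _ (Nat.pos_of_ne_zero hni)).trans (mod_cast hkt.le)

lemma tendsto_descFactorial_div (ht : IsCollectionScale l n d t x) (hn : Tendsto n l atTop)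
    {J : ι → ℕ} (hJ : IsSmallMultiplicity l n d J) :
    Tendsto (fun i => ((t i).descFactorial (J i) : ℝ) / (n i * Real.log (n i)) ^ J i) l
      (𝓝 1) := by
  have hJn := hJ.tendsto_div_natCast hn
  have hJt : Tendsto (fun i => (J i : ℝ) / t i) l (𝓝 0) := by
    have hmul := hJn.mul (ht.tendsto_natCast_div hn)
    rw [zero_mul] at hmul
    refine hmul.congr' ?_
    filter_upwards [hn.eventually_ne_atTop 0] with i hi
    field_simp
  have hJsq : Tendsto (fun i => (J i : ℝ) ^ 2 / t i) l (𝓝 0) := by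
    have hmul := hJn.mul (ht.tendsto_mul_natCast_div hn hJ)
    rw [zero_mul] at hmul
    refine hmul.congr' ?_
    filter_upwards [hn.eventually_ne_atTop 0] with i hi
    field_simp
  have hpow := tendsto_one_add_pow_one (ht.tendsto_div_mul_log_sub_one hn)
    (ht.tendsto_mul_div_mul_log_sub_one hn hJ)
  have hmul := (tendsto_descFactorial_div_pow hJt hJsq (ht.eventually_ne_zero hn)).mul hpow
  rw [mul_one] at hmul
  refine hmul.congr' ?_
  filter_upwards [ht.eventually_ne_zero hn] with i hi
  rw [add_sub_cancel, div_pow, div_mul_div_cancel₀ (pow_ne_zero _ (Nat.cast_ne_zero.2 hi))]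

lemma tendsto_one_sub_pow_mul (ht : IsCollectionScale l n d t x) (hn : Tendsto n l atTop)
    (r : ℕ) :
    Tendsto (fun i => (1 - r / n i : ℝ) ^ t i * (n i * Real.log (n i) ^ d) ^ r) l
      (𝓝 (Real.exp (-x) ^ r)) := by
  have hn' : Tendsto (fun i => (n i : ℝ)) l atTop := tendsto_natCast_atTop_atTop.comp hn
  have hu : Tendsto (fun i => -(r / n i : ℝ)) l (𝓝 0) := by
    simpa using (tendsto_const_nhds.div_atTop hn').neg
  have htu : Tendsto (fun i => t i * (-(r / n i : ℝ)) ^ 2) l (𝓝 0) := by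
    have hmul := ((ht.tendsto_div_mul_log hn).mul (tendsto_log_div_natCast hn)).const_mul
      ((r : ℝ) ^ 2)
    rw [mul_zero, mul_zero] at hmul
    refine hmul.congr' ?_
    filter_upwards [(tendsto_log_natCast hn).eventually_ne_atTop 0] with i hi
    field_simp
  have hexp := (Tendsto.neg ht).rexp.pow r
  have hmul := (tendsto_one_add_pow_mul_exp hu htu).mul hexp
  rw [one_mul] at hmul
  refine hmul.congr' ?_
  filter_upwards [hn.eventually_ne_atTop 0, (tendsto_log_natCast hn).eventually_gt_atTop 0]
    with i hni hlog
  have hni' : (0 : ℝ) < n i := mod_cast Nat.pos_of_ne_zero hni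
  have hbase : n i * Real.log (n i) ^ d =
      Real.exp (Real.log (n i) + d * Real.log (Real.log (n i))) := by
    rw [Real.exp_add, Real.exp_log hni', Real.exp_nat_mul, Real.exp_log hlog]
  rw [hbase, mul_assoc, ← Real.exp_nat_mul, ← Real.exp_nat_mul, ← Real.exp_add, ← sub_eq_add_neg]
  congr 2
  rw [centredTime]
  ring

lemma tendsto_descFactorial_mul_one_sub_pow (ht : IsCollectionScale l n d t x)
    (hn : Tendsto n l atTop) {J : ι → ℕ} (hJ : IsSmallMultiplicity l n d J) (r : ℕ) :
    Tendsto (fun i => ((t i).descFactorial (J i) : ℝ) / (n i * Real.log (n i)) ^ J i *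
      ((1 - r / n i : ℝ) ^ (t i - J i) * (n i * Real.log (n i) ^ d) ^ r)) l
      (𝓝 (Real.exp (-x) ^ r)) := by
  have hn' : Tendsto (fun i => (n i : ℝ)) l atTop := tendsto_natCast_atTop_atTop.comp hn
  have hu : Tendsto (fun i => -(r / n i : ℝ)) l (𝓝 0) := by
    simpa using (tendsto_const_nhds.div_atTop hn').neg
  have hJu : Tendsto (fun i => J i * -(r / n i : ℝ)) l (𝓝 0) := by
    have hmul := (hJ.tendsto_div_natCast hn).const_mul (-r : ℝ)
    rw [mul_zero] at hmul
    exact hmul.congr fun i => by ring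
  have hpow := (tendsto_one_add_pow_one hu hJu).inv₀ one_ne_zero
  have hmul := (ht.tendsto_descFactorial_div hn hJ).mul
    ((ht.tendsto_one_sub_pow_mul hn r).mul hpow)
  rw [inv_one, mul_one, one_mul] at hmul
  refine hmul.congr' ?_
  filter_upwards [hn.eventually_gt_atTop r, ht.eventually_le hn hJ] with i hni hle
  have hr : (1 : ℝ) - r / n i ≠ 0 :=
    (sub_pos.2 ((div_lt_one (mod_cast pos_of_gt hni)).2 (mod_cast hni))).ne'
  rw [pow_sub₀ _ hr hle, ← sub_eq_add_neg]
  ring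

lemma tendsto_occupancyProb {κ : Type*} [Fintype κ] (ht : IsCollectionScale l n d t x)
    (hn : Tendsto n l atTop) {j : ι → κ → ℕ}
    (hj : IsSmallMultiplicity l n d fun i => ∑ c, j i c) :
    Tendsto (fun i => occupancyProb (n i) (t i) (j i) * (n i : ℝ) ^ Fintype.card κ *
        ((∏ c, (j i c)! : ℕ) * Real.log (n i) ^ (d * Fintype.card κ) /
          Real.log (n i) ^ ∑ c, j i c)) l
      (𝓝 (Real.exp (-x) ^ Fintype.card κ)) := by
  refine (ht.tendsto_descFactorial_mul_one_sub_pow hn hj (Fintype.card κ)).congr fun i => ?_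
  have hfact : ((∏ c, (j i c)! : ℕ) : ℝ) ≠ 0 := by positivity
  rw [occupancyProb, mul_pow, mul_pow, ← pow_mul]
  field_simp

lemma tendsto_occupancyProb_of_le {κ : Type*} [Fintype κ]
    (ht : IsCollectionScale l n d t x) (hn : Tendsto n l atTop) (j : κ → Fin (d + 1)) :
    Tendsto (fun i => occupancyProb (n i) (t i) (fun c => (j c : ℕ)) *
        (n i : ℝ) ^ Fintype.card κ) l
      (𝓝 (if j = fun _ => Fin.last d then (Real.exp (-x) / d !) ^ Fintype.card κ else 0)) := by
  have hlog := tendsto_log_natCast hn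
  have hocc := ht.tendsto_occupancyProb (j := fun _ c => (j c : ℕ)) hn
    (isSmallMultiplicity_const hn d _)
  have hratio : Tendsto (fun i => Real.log (n i) ^ (∑ c, (j c : ℕ)) /
      Real.log (n i) ^ (d * Fintype.card κ)) l
      (𝓝 (if j = fun _ => Fin.last d then 1 else 0)) := by
    split_ifs with hj
    · refine tendsto_const_nhds.congr' ?_
      filter_upwards [hlog.eventually_ne_atTop 0] with i hi
      simp [hj, mul_comm d, hi]
    · refine (tendsto_pow_div_pow_atTop_zero ?_).comp hlog
      obtain ⟨c, hc⟩ := Function.ne_iff.1 hj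
      calc ∑ c, (j c : ℕ) < ∑ _ : κ, d :=
            Finset.sum_lt_sum (fun c _ => Fin.is_le _) ⟨c, Finset.mem_univ c, Fin.val_lt_last hc⟩
        _ = d * Fintype.card κ := by simp [mul_comm]
  have hmul := (hocc.mul hratio).div_const ((∏ c, (j c : ℕ)! : ℕ) : ℝ)
  convert hmul.congr' ?_ using 2
  · split_ifs with hj
    · simp [hj, div_pow]
    · simp
  · filter_upwards [hlog.eventually_ne_atTop 0] with i hi
    have hfact : ((∏ c, (j c : ℕ)! : ℕ) : ℝ) ≠ 0 := by positivity
    field_simp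

end IsCollectionScale

end Scales

namespace IsCouponSequence

variable {Ω : Type*} [MeasurableSpace Ω] {P : Measure Ω} {n : ℕ} {draw : ℕ → Ω → Fin n}

lemma measurable_card_filter_copies (h : IsCouponSequence P draw) (t : ℕ) (q : ℕ → Prop)
    [DecidablePred q] :
    Measurable fun ω => (Finset.univ.filter fun c => q (copies (draw · ω) t c)).card :=
  (measurable_of_countable fun v : Fin n → ℕ => (Finset.univ.filter fun c => q (v c)).card).comp
    (h.measurable_copies t)

lemma integral_choose_card_copies_lt (h : IsCouponSequence P draw) (t m r : ℕ) :
    ∫ ω, ((Finset.univ.filter fun c => copies (draw · ω) t c < m).card.choose r : ℝ) ∂P =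
      n.choose r * ∑ j : Fin r → Fin m, occupancyProb n t fun i => (j i : ℕ) := by
  have := h.indep.isProbabilityMeasure
  rw [integral_choose_card_filter_of_forall_embedding
    (fun c => h.measurableSet_copies t fun v => v c < m) fun e => h.measureReal_copies_lt e t m,
    Fintype.card_fin]

lemma integral_choose_card_copies_eq (h : IsCouponSequence P draw) (t k r : ℕ) :
    ∫ ω, ((Finset.univ.filter fun c => copies (draw · ω) t c = k).card.choose r : ℝ) ∂P =
      n.choose r * occupancyProb n t fun _ : Fin r => k := by
  have := h.indep.isProbabilityMeasure
  have hlaw (e : Fin r ↪ Fin n) : P.real {ω | ∀ i, copies (draw · ω) t (e i) = k} =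
      occupancyProb n t fun _ : Fin r => k := by
    simpa only [funext_iff, Function.comp_apply] using h.measureReal_copies_comp_eq e t fun _ => k
  rw [integral_choose_card_filter_of_forall_embedding
    (fun c => h.measurableSet_copies t fun v => v c = k) hlaw, Fintype.card_fin]

end IsCouponSequence

/-- The reciprocal of the order of magnitude of the number of `k`-tons in a collection of `d + 1`
copies of each of `n` types, where `d < k`. For `k < d` the truncated exponent is meaningless. -/
noncomputable def tonScale (n d k : ℕ) : ℝ :=
  k ! / Real.log n ^ (k - d)

lemma tonScale_nonneg (n d k : ℕ) : 0 ≤ tonScale n d k :=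
  div_nonneg (Nat.cast_nonneg _) (pow_nonneg (Real.log_natCast_nonneg n) _)

section FixedTime

variable {ι : Type*} {l : Filter ι} {n : ι → ℕ} {d : ℕ} {t : ι → ℕ} {x : ℝ} {k : ι → ℕ}

lemma factorial_le_factorial_mul_pow {a k : ℕ} (hak : a ≤ k) : k ! ≤ a ! * k ^ (k - a) := by
  rw [← Nat.factorial_mul_descFactorial (Nat.sub_le k a), Nat.sub_sub_self hak]
  gcongr
  exact Nat.descFactorial_le_pow _ _

lemma tendsto_tonScale (hn : Tendsto n l atTop) (hk : IsSmallMultiplicity l n d k)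
    (hdk : ∀ᶠ i in l, d < k i) : Tendsto (fun i => tonScale (n i) d (k i)) l (𝓝 0) := by
  have hlog := tendsto_log_natCast hn
  refine squeeze_zero' ?_ ?_ (tendsto_const_nhds.div_atTop hlog : Tendsto
    (fun i => ((d + 1)! : ℝ) / Real.log (n i)) l (𝓝 0))
  · exact .of_forall fun i => tonScale_nonneg _ _ _
  · filter_upwards [hlog.eventually_gt_atTop 0, hdk,
      (hk.tendsto_div_log hn).eventually_lt_const one_pos] with i hi hdki hki
    rw [div_lt_one hi] at hki
    have hfact : ((k i)! : ℝ) ≤ (d + 1)! * (k i : ℝ) ^ (k i - (d + 1)) :=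
      mod_cast factorial_le_factorial_mul_pow hdki
    rw [tonScale, show k i - d = k i - (d + 1) + 1 by omega, pow_succ, div_mul_eq_div_div]
    gcongr
    rw [div_le_iff₀ (by positivity)]
    exact hfact.trans (by gcongr)

lemma IsCollectionScale.tendsto_occupancyProb_mul_tonScale (ht : IsCollectionScale l n d t x)
    (hn : Tendsto n l atTop) (hk : IsSmallMultiplicity l n d k) (hdk : ∀ᶠ i in l, d < k i)
    (r : ℕ) :
    Tendsto (fun i => tonScale (n i) d (k i) ^ r *
      ((n i).choose r * occupancyProb (n i) (t i) fun _ : Fin r => k i)) l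
      (𝓝 (Real.exp (-x) ^ r / r !)) := by
  have hj : IsSmallMultiplicity l n d fun i => ∑ _ : Fin r, k i := by
    simpa using hk.const_mul r
  have hmul := (ht.tendsto_occupancyProb hn hj).mul (tendsto_choose_div_pow hn r)
  rw [Fintype.card_fin, mul_one_div] at hmul
  refine hmul.congr' ?_
  filter_upwards [hn.eventually_ne_atTop 0, (tendsto_log_natCast hn).eventually_ne_atTop 0, hdk]
    with i hni hlog hdki
  obtain ⟨b, hb⟩ : ∃ b, k i = d + b := Nat.exists_eq_add_of_le hdki.le
  simp only [tonScale, Finset.sum_const, Finset.prod_const, Finset.card_univ, Fintype.card_fin,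
    smul_eq_mul, hb, Nat.add_sub_cancel_left, div_pow, ← pow_mul, Nat.cast_pow]
  field_simp
  ring

variable {Ω : ι → Type*} [∀ i, MeasurableSpace (Ω i)] {P : ∀ i, Measure (Ω i)}
  [∀ i, IsProbabilityMeasure (P i)] {draw : ∀ i, ℕ → Ω i → Fin (n i)}

lemma IsCollectionScale.tendsto_measureReal_le_abs_tons_sub (ht : IsCollectionScale l n d t x)
    (hn : Tendsto n l atTop) (hdraw : ∀ i, IsCouponSequence (P i) (draw i))
    (hk : IsSmallMultiplicity l n d k) (hdk : ∀ᶠ i in l, d < k i) {δ : ℝ} (hδ : 0 < δ) :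
    Tendsto (fun i => (P i).real {ω | δ ≤ |tonScale (n i) d (k i) *
      (Finset.univ.filter fun c => copies (draw i · ω) (t i) c = k i).card - Real.exp (-x)|}) l
      (𝓝 0) := by
  have hmoment (r : ℕ) : Tendsto (fun i => tonScale (n i) d (k i) ^ r * ∫ ω,
      ((Finset.univ.filter fun c => copies (draw i · ω) (t i) c = k i).card.choose r : ℝ) ∂P i) l
      (𝓝 (Real.exp (-x) ^ r / r !)) := by
    simpa only [(hdraw _).integral_choose_card_copies_eq] using
      ht.tendsto_occupancyProb_mul_tonScale hn hk hdk r
  refine tendsto_measureReal_le_abs_sub_of_factorial_moments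
    (fun i r => integrable_choose_card_filter
      (fun c => (hdraw i).measurableSet_copies (t i) fun v => v c = k i) r)
    (tendsto_tonScale hn hk hdk) ?_ ?_ hδ
  · simpa only [pow_one, Nat.factorial_one, Nat.cast_one, div_one] using hmoment 1
  · simpa only [Nat.factorial_two, Nat.cast_ofNat] using hmoment 2

lemma IsCollectionScale.tendsto_measureReal_forall_lt_copies (ht : IsCollectionScale l n d t x)
    (hn : Tendsto n l atTop) (hdraw : ∀ i, IsCouponSequence (P i) (draw i)) :
    Tendsto (fun i => (P i).real {ω | ∀ c, d < copies (draw i · ω) (t i) c}) l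
      (𝓝 (Real.exp (-(Real.exp (-x) / d !)))) := by
  have hmoment (r : ℕ) : Tendsto (fun i => ∫ ω,
      ((Finset.univ.filter fun c => copies (draw i · ω) (t i) c < d + 1).card.choose r : ℝ) ∂P i) l
      (𝓝 ((Real.exp (-x) / d !) ^ r / r !)) := by
    simp only [(hdraw _).integral_choose_card_copies_lt]
    have hsum := tendsto_finsetSum Finset.univ fun (j : Fin r → Fin (d + 1)) _ =>
      ht.tendsto_occupancyProb_of_le hn j
    have hmul := hsum.mul (tendsto_choose_div_pow hn r)
    rw [Finset.sum_ite_eq' Finset.univ, if_pos (Finset.mem_univ _), Fintype.card_fin,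
      mul_one_div] at hmul
    refine hmul.congr' ?_
    filter_upwards [hn.eventually_ne_atTop 0] with i hni
    rw [← Finset.sum_mul]
    field_simp
  have hzero := tendsto_measureReal_eq_zero_of_factorial_moments
    (fun i => (hdraw i).measurable_card_filter_copies (t i) (· < d + 1))
    (fun i r => integrable_choose_card_filter
      (fun c => (hdraw i).measurableSet_copies (t i) fun v => v c < d + 1) r)
    hmoment
  simpa [Finset.filter_eq_empty_iff, Nat.succ_le_iff] using hzero

end FixedTime

section RareTypes

lemma sum_range_le_of_le_mul_succ {f : ℕ → ℝ} {ρ : ℝ} (hf : ∀ j, 0 ≤ f j) (hρ₀ : 0 ≤ ρ)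
    (hρ : ρ ≤ 1 / 2) {k : ℕ} (hstep : ∀ j < k, f j ≤ ρ * f (j + 1)) :
    ∑ j ∈ Finset.range k, f j ≤ 2 * ρ * f k := by
  induction k with
  | zero =>
    have := hf 0
    simp only [Finset.range_zero, Finset.sum_empty]
    positivity
  | succ k ih =>
    rw [Finset.sum_range_succ]
    have hsum := ih fun j hj => hstep j (Nat.lt_succ_of_lt hj)
    have hlast := hstep k (Nat.lt_succ_self k)
    have hhalf : ρ * f k ≤ 1 / 2 * f k := mul_le_mul_of_nonneg_right hρ (hf k)
    linarith

lemma succ_mul_occupancyProb_succ {n t j : ℕ} (hn : n ≠ 0) (hj : j < t) :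
    ((j : ℝ) + 1) * (n - 1) * occupancyProb n t (fun _ : Fin 1 => j + 1) =
      (t - j) * occupancyProb n t fun _ : Fin 1 => j := by
  obtain ⟨u, rfl⟩ : ∃ u, t = j + 1 + u := Nat.exists_eq_add_of_le hj
  have hn' : (n : ℝ) ≠ 0 := mod_cast hn
  simp only [occupancyProb, Finset.sum_const, Finset.prod_const, Finset.card_univ,
    Fintype.card_fin, one_smul, pow_one, Nat.descFactorial_succ, Nat.factorial_succ,
    show j + 1 + u - j = u + 1 by omega, show j + 1 + u - (j + 1) = u by omega]
  have hbase : (n : ℝ) - 1 = n * (1 - (1 : ℕ) / n) := by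
    rw [Nat.cast_one, mul_sub, mul_one, mul_one_div_cancel hn']
  rw [hbase]
  generalize (1 : ℝ) - (1 : ℕ) / n = z
  push_cast
  field_simp
  ring

lemma occupancyProb_nonneg {κ : Type*} [Fintype κ] {n : ℕ} (hn : Fintype.card κ ≤ n) (t : ℕ)
    (j : κ → ℕ) : 0 ≤ occupancyProb n t j := by
  have hbase : (0 : ℝ) ≤ 1 - Fintype.card κ / n :=
    sub_nonneg.2 (div_le_one_of_le₀ (mod_cast hn) (Nat.cast_nonneg n))
  rw [occupancyProb]
  positivity

lemma occupancyProb_le_mul_succ {n t j k : ℕ} (hn : n ≠ 0) (hj : j < k) (hk : 2 * k ≤ t) :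
    occupancyProb n t (fun _ : Fin 1 => j) ≤
      2 * (k * n / t) * occupancyProb n t fun _ : Fin 1 => j + 1 := by
  have hjk : (j : ℝ) + 1 ≤ k := mod_cast hj
  have hkt : 2 * (k : ℝ) ≤ t := mod_cast hk
  have ht : (0 : ℝ) < t := by linarith [Nat.cast_nonneg (α := ℝ) j]
  have hn' : (1 : ℝ) ≤ n := mod_cast Nat.one_le_iff_ne_zero.2 hn
  have hprob := occupancyProb_nonneg (κ := Fin 1) (by simpa [Nat.one_le_iff_ne_zero] using hn) t
  have hratio := succ_mul_occupancyProb_succ (t := t) hn (by omega : j < t)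
  have hle : t / 2 * occupancyProb n t (fun _ : Fin 1 => j) ≤
      k * n * occupancyProb n t fun _ : Fin 1 => j + 1 := calc
    t / 2 * occupancyProb n t (fun _ : Fin 1 => j) ≤
        (t - j) * occupancyProb n t fun _ : Fin 1 => j :=
      mul_le_mul_of_nonneg_right (by linarith) (hprob _)
    _ = (j + 1) * (n - 1) * occupancyProb n t fun _ : Fin 1 => j + 1 := hratio.symm
    _ ≤ k * n * occupancyProb n t fun _ : Fin 1 => j + 1 :=
      mul_le_mul_of_nonneg_right (by gcongr; linarith) (hprob _)
  calc occupancyProb n t (fun _ : Fin 1 => j) =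
        2 / t * (t / 2 * occupancyProb n t fun _ : Fin 1 => j) := by field_simp
    _ ≤ 2 / t * (k * n * occupancyProb n t fun _ : Fin 1 => j + 1) := by gcongr
    _ = 2 * (k * n / t) * occupancyProb n t fun _ : Fin 1 => j + 1 := by ring

lemma sum_occupancyProb_le {n t k : ℕ} (hn : n ≠ 0) (hkt : 4 * (k * n) ≤ t) :
    ∑ j : Fin 1 → Fin k, occupancyProb n t (fun i => (j i : ℕ)) ≤
      4 * (k * n / t) * occupancyProb n t fun _ : Fin 1 => k := by
  have hsum : ∑ j : Fin 1 → Fin k, occupancyProb n t (fun i => (j i : ℕ)) =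
      ∑ j ∈ Finset.range k, occupancyProb n t fun _ : Fin 1 => j := by
    rw [← Fin.sum_univ_eq_sum_range fun j => occupancyProb n t fun _ : Fin 1 => j,
      ← (Equiv.funUnique (Fin 1) (Fin k)).sum_comp]
    refine Finset.sum_congr rfl fun j _ => congrArg _ (funext fun i => ?_)
    rw [Subsingleton.elim i default]
    rfl
  have hk : 2 * k ≤ t := by nlinarith [Nat.pos_of_ne_zero hn]
  have hρ : 2 * ((k : ℝ) * n / t) ≤ 1 / 2 := by
    have hle := div_le_one_of_le₀ (by exact_mod_cast hkt : 4 * ((k : ℝ) * n) ≤ t)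
      (Nat.cast_nonneg t)
    rw [mul_div_assoc] at hle
    linarith
  rw [hsum]
  refine (sum_range_le_of_le_mul_succ
    (fun j => occupancyProb_nonneg (by simpa [Nat.one_le_iff_ne_zero] using hn) t _) (by positivity)
    hρ fun j hj => occupancyProb_le_mul_succ (j := j) hn hj hk).trans_eq ?_
  ring

end RareTypes

section RareTypesFixedTime

variable {ι : Type*} {l : Filter ι} {n : ι → ℕ} {d : ℕ} {t : ι → ℕ} {x : ℝ} {k : ι → ℕ}
  {Ω : ι → Type*} [∀ i, MeasurableSpace (Ω i)] {P : ∀ i, Measure (Ω i)}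
  {draw : ∀ i, ℕ → Ω i → Fin (n i)}

lemma IsCollectionScale.tendsto_tonScale_mul_integral_copies_lt (ht : IsCollectionScale l n d t x)
    (hn : Tendsto n l atTop) (hdraw : ∀ i, IsCouponSequence (P i) (draw i))
    (hk : IsSmallMultiplicity l n d k) (hdk : ∀ᶠ i in l, d < k i) :
    Tendsto (fun i => tonScale (n i) d (k i) * ∫ ω,
      ((Finset.univ.filter fun c => copies (draw i · ω) (t i) c < k i).card : ℝ) ∂P i) l
      (𝓝 0) := by
  have hmul := ((ht.tendsto_mul_natCast_div hn hk).const_mul 4).mul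
    (ht.tendsto_occupancyProb_mul_tonScale hn hk hdk 1)
  rw [mul_zero, zero_mul] at hmul
  refine squeeze_zero' (.of_forall fun i =>
    mul_nonneg (tonScale_nonneg _ _ _) (integral_nonneg fun ω => Nat.cast_nonneg _)) ?_ hmul
  filter_upwards [hn.eventually_ne_atTop 0, ht.eventually_ne_zero hn,
    (ht.tendsto_mul_natCast_div hn hk).eventually_le_const (show (0 : ℝ) < 1 / 4 by norm_num)]
    with i hni hti hkt
  have hkt' : 4 * (k i * n i) ≤ t i := by
    rw [div_le_iff₀ (mod_cast Nat.pos_of_ne_zero hti)] at hkt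
    have hreal : 4 * ((k i : ℝ) * n i) ≤ t i := by linarith
    exact_mod_cast hreal
  have hmean := (hdraw i).integral_choose_card_copies_lt (t i) (k i) 1
  simp only [Nat.choose_one_right] at hmean
  rw [hmean, pow_one, Nat.choose_one_right]
  calc tonScale (n i) d (k i) * (n i * ∑ j : Fin 1 → Fin (k i), occupancyProb (n i) (t i) _) ≤
        tonScale (n i) d (k i) * (n i *
          (4 * (k i * n i / t i) * occupancyProb (n i) (t i) fun _ : Fin 1 => k i)) := by
        gcongr
        · exact tonScale_nonneg _ _ _
        · exact sum_occupancyProb_le hni hkt'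
    _ = _ := by ring

variable [∀ i, IsProbabilityMeasure (P i)]

lemma IsCollectionScale.tendsto_measureReal_le_tonScale_mul_copies_lt
    (ht : IsCollectionScale l n d t x) (hn : Tendsto n l atTop)
    (hdraw : ∀ i, IsCouponSequence (P i) (draw i)) (hk : IsSmallMultiplicity l n d k)
    (hdk : ∀ᶠ i in l, d < k i) {δ : ℝ} (hδ : 0 < δ) :
    Tendsto (fun i => (P i).real {ω | δ ≤ tonScale (n i) d (k i) *
      (Finset.univ.filter fun c => copies (draw i · ω) (t i) c < k i).card}) l (𝓝 0) := by
  have hlim := (ht.tendsto_tonScale_mul_integral_copies_lt hn hdraw hk hdk).div_const δ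
  rw [zero_div] at hlim
  refine squeeze_zero (fun i => measureReal_nonneg) (fun i => ?_) hlim
  have hint := integrable_choose_card_filter (P := P i)
    (fun c => (hdraw i).measurableSet_copies (t i) fun v => v c < k i) 1
  simp only [Nat.choose_one_right] at hint
  rw [le_div_iff₀' hδ, ← integral_const_mul]
  exact mul_meas_ge_le_integral_of_nonneg (.of_forall fun ω =>
    mul_nonneg (tonScale_nonneg _ _ _) (Nat.cast_nonneg _)) (hint.const_mul _) δ

end RareTypesFixedTime

section Distribution

variable {ι Ω' : Type*} {Ω : ι → Type*} [∀ i, MeasurableSpace (Ω i)]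
  {μ : ∀ i, Measure (Ω i)} [∀ i, IsProbabilityMeasure (μ i)]
  [MeasurableSpace Ω'] {μ' : Measure Ω'} [IsProbabilityMeasure μ'] {l : Filter ι}

-- Slutsky's theorem in Mathlib needs all variables on one probability space; the product of the
-- given spaces is one.
lemma tendstoInDistribution_comp_eval_infinitePi_iff {E : Type*} [TopologicalSpace E]
    [MeasurableSpace E] [OpensMeasurableSpace E] {X : ∀ i, Ω i → E} {Z : Ω' → E}
    (hX : ∀ i, AEMeasurable (X i) (μ i)) :
    TendstoInDistribution (fun i (ω : ∀ i, Ω i) => X i (ω i)) l Z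
      (fun _ => Measure.infinitePi μ) μ' ↔ TendstoInDistribution X l Z μ μ' := by
  have heval (i : ι) := measurePreserving_eval_infinitePi μ i
  have hmap (i : ι) : (Measure.infinitePi μ).map (fun ω => X i (ω i)) = (μ i).map (X i) := by
    have hXi : AEMeasurable (X i) ((Measure.infinitePi μ).map (Function.eval i)) := by
      rw [(heval i).map_eq]
      exact hX i
    rw [← (heval i).map_eq, hXi.map_map_of_aemeasurable (heval i).aemeasurable]
    rfl
  have hX' (i : ι) : AEMeasurable (fun ω => X i (ω i)) (Measure.infinitePi μ) :=
    (hX i).comp_quasiMeasurePreserving (heval i).quasiMeasurePreserving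
  constructor
  · rintro ⟨_, hZ, h⟩
    refine ⟨hX, hZ, ?_⟩
    simpa only [hmap] using h
  · rintro ⟨_, hZ, h⟩
    refine ⟨hX', hZ, ?_⟩
    simpa only [hmap] using h

lemma tendstoInDistribution_of_tendsto_measureReal_sub [l.IsCountablyGenerated] {E : Type*}
    [NormedAddCommGroup E] [SecondCountableTopology E] [MeasurableSpace E] [BorelSpace E]
    {X Y : ∀ i, Ω i → E} {Z : Ω' → E} (hXZ : TendstoInDistribution X l Z μ μ')
    (hXY : ∀ ε > 0, Tendsto (fun i => (μ i).real {ω | ε ≤ ‖Y i ω - X i ω‖}) l (𝓝 0))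
    (hY : ∀ i, AEMeasurable (Y i) (μ i)) : TendstoInDistribution Y l Z μ μ' := by
  have hX := hXZ.forall_aemeasurable
  have heval (i : ι) := measurePreserving_eval_infinitePi μ i
  rw [← tendstoInDistribution_comp_eval_infinitePi_iff hX] at hXZ
  rw [← tendstoInDistribution_comp_eval_infinitePi_iff hY]
  refine tendstoInDistribution_of_tendstoInMeasure_sub _ Z hXZ ?_
    fun i => (hY i).comp_quasiMeasurePreserving (heval i).quasiMeasurePreserving
  rw [tendstoInMeasure_iff_measureReal_norm]
  intro ε hε
  refine (hXY ε hε).congr fun i => ?_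
  have hnull : NullMeasurableSet {ω | ε ≤ ‖Y i ω - X i ω‖} (μ i) :=
    nullMeasurableSet_le aemeasurable_const ((hY i).sub (hX i)).norm
  simpa using ((heval i).measureReal_preimage hnull).symm

lemma map_measureReal_Ioc {W : Ω' → ℝ} (hW : AEMeasurable W μ') {a b : ℝ} (hab : a ≤ b) :
    (μ'.map W).real (Set.Ioc a b) = μ'.real {ω | W ω ≤ b} - μ'.real {ω | W ω ≤ a} := by
  have := Measure.isProbabilityMeasure_map hW
  rw [← Set.Iic_sdiff_Iic, measureReal_sdiff (Set.Iic_subset_Iic.2 hab) measurableSet_Iic,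
    map_measureReal_apply_of_aemeasurable hW measurableSet_Iic,
    map_measureReal_apply_of_aemeasurable hW measurableSet_Iic]
  rfl

lemma tendstoInDistribution_of_tendsto_measureReal_le [l.IsCountablyGenerated]
    {X : ∀ i, Ω i → ℝ} {Z : Ω' → ℝ} (hX : ∀ i, AEMeasurable (X i) (μ i)) (hZ : AEMeasurable Z μ')
    (h : ∀ x, Tendsto (fun i => (μ i).real {ω | X i ω ≤ x}) l (𝓝 (μ'.real {ω | Z ω ≤ x}))) :
    TendstoInDistribution X l Z μ μ' := by
  refine ⟨hX, hZ, (isPiSystem_Ioc id id).tendsto_probabilityMeasure_of_tendsto_of_mem ?_ ?_ ?_⟩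
  · rintro _ ⟨a, b, -, rfl⟩
    exact measurableSet_Ioc
  · intro u hu x hx
    obtain ⟨a, b, hxab, hab⟩ := mem_nhds_iff_exists_Ioo_subset.1 (hu.mem_nhds hx)
    obtain ⟨c, hxc, hcb⟩ := exists_between hxab.2
    exact ⟨Set.Ioc a c, ⟨a, c, hxab.1.trans hxc, rfl⟩, Ioc_mem_nhds hxab.1 hxc,
      (Set.Ioc_subset_Ioo_right hcb).trans hab⟩
  · rintro _ ⟨a, b, hab : a < b, rfl⟩
    rw [← NNReal.tendsto_coe]
    have := Measure.isProbabilityMeasure_map hZ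
    have := fun i => Measure.isProbabilityMeasure_map (hX i)
    have hsub := (h b).sub (h a)
    rw [← map_measureReal_Ioc hZ hab.le] at hsub
    exact hsub.congr fun i => (map_measureReal_Ioc (hX i) hab.le).symm

lemma exists_isCompact_measureReal_notMem_lt {E : Type*} [PseudoMetricSpace E]
    [ProperSpace E] [MeasurableSpace E] [BorelSpace E] {X : ∀ i, Ω i → E} {Z : Ω' → E}
    (hXZ : TendstoInDistribution X l Z μ μ') {η : ℝ} (hη : 0 < η) :
    ∃ K : Set E, IsCompact K ∧ ∀ᶠ i in l, (μ i).real {ω | X i ω ∉ K} < η := by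
  have := Measure.isProbabilityMeasure_map hXZ.aemeasurable_limit
  obtain ⟨K₀, hK₀, hZK₀⟩ := isTightMeasureSet_iff_exists_isCompact_measure_compl_le.1
    (isTightMeasureSet_singleton (μ := μ'.map Z)) (ENNReal.ofReal (η / 2)) (by simpa using hη)
  obtain ⟨K, hK, hK₀K⟩ := exists_compact_superset hK₀
  have hlim : limsup (fun i => (μ i).map (X i) (interior K)ᶜ) l < ENNReal.ofReal η := calc
    limsup (fun i => (μ i).map (X i) (interior K)ᶜ) l ≤ μ'.map Z (interior K)ᶜ :=
      ProbabilityMeasure.limsup_measure_closed_le_of_tendsto hXZ.tendsto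
        isOpen_interior.isClosed_compl
    _ ≤ μ'.map Z K₀ᶜ := by gcongr
    _ ≤ ENNReal.ofReal (η / 2) := hZK₀ _ rfl
    _ < ENNReal.ofReal η := (ENNReal.ofReal_lt_ofReal_iff hη).2 (half_lt_self hη)
  refine ⟨K, hK, ?_⟩
  filter_upwards [eventually_lt_of_limsup_lt hlim] with i hi
  rw [Measure.map_apply_of_aemeasurable (hXZ.forall_aemeasurable i)
    isOpen_interior.measurableSet.compl] at hi
  refine (ENNReal.lt_ofReal_iff_toReal_lt (measure_ne_top _ _)).1 (lt_of_le_of_lt ?_ hi)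
  exact measure_mono fun ω hω hint => hω (interior_subset hint)

lemma tendsto_measureReal_of_forall_exists_nhds {E : Type*} [PseudoMetricSpace E]
    [ProperSpace E] [MeasurableSpace E] [BorelSpace E] {X : ∀ i, Ω i → E} {Z : Ω' → E}
    (hXZ : TendstoInDistribution X l Z μ μ') {A : ∀ i, Set (Ω i)}
    (hA : ∀ x, ∃ U ∈ 𝓝 x, Tendsto (fun i => (μ i).real (A i ∩ X i ⁻¹' U)) l (𝓝 0)) :
    Tendsto (fun i => (μ i).real (A i)) l (𝓝 0) := by
  rw [Metric.tendsto_nhds]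
  intro η hη
  obtain ⟨K, hK, hXK⟩ := exists_isCompact_measureReal_notMem_lt hXZ (half_pos hη)
  have hAK : Tendsto (fun i => (μ i).real (A i ∩ X i ⁻¹' K)) l (𝓝 0) := by
    refine hK.induction_on (p := fun s => Tendsto (fun i => (μ i).real (A i ∩ X i ⁻¹' s)) l (𝓝 0))
      ?_ ?_ ?_ ?_
    · simpa using tendsto_const_nhds
    · intro s t hst ht
      exact squeeze_zero (fun _ => measureReal_nonneg) (fun i => measureReal_mono (by gcongr)) ht
    · intro s t hs ht
      have hst := hs.add ht
      rw [add_zero] at hst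
      refine squeeze_zero (fun _ => measureReal_nonneg) (fun i => ?_) hst
      rw [Set.preimage_union, Set.inter_union_distrib_left]
      exact measureReal_union_le _ _
    · intro x _
      obtain ⟨U, hU, hAU⟩ := hA x
      exact ⟨U, mem_nhdsWithin_of_mem_nhds hU, hAU⟩
  filter_upwards [hXK, hAK.eventually_lt_const (half_pos hη)] with i hout hin
  rw [Real.dist_0_eq_abs, abs_of_nonneg measureReal_nonneg]
  calc (μ i).real (A i) ≤ (μ i).real (A i ∩ X i ⁻¹' K ∪ {ω | X i ω ∉ K}) :=
        measureReal_mono fun ω hω => by by_cases hK : X i ω ∈ K <;> simp [hω, hK]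
    _ ≤ (μ i).real (A i ∩ X i ⁻¹' K) + (μ i).real {ω | X i ω ∉ K} := measureReal_union_le _ _
    _ < η := by linarith

end Distribution

section Deterministic

variable {n m : ℕ} {x : ℕ → Fin n}

lemma collectionTime_le_iff {t : ℕ} : collectionTime m x ≤ t ↔
    (∀ c, m ≤ copies x t c) ∨ ∀ s, ∃ c, copies x s c < m := by
  rw [collectionTime]
  rcases Set.eq_empty_or_nonempty {s | ∀ c, m ≤ copies x s c} with hempty | hne
  · rw [hempty, Nat.sInf_empty]
    have hnever (s : ℕ) : ∃ c, copies x s c < m := by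
      simpa using Set.eq_empty_iff_forall_notMem.1 hempty s
    simp [hnever]
  · obtain ⟨s, hs⟩ := hne
    have hnot : ¬ ∀ s, ∃ c, copies x s c < m := fun h => by
      obtain ⟨c, hc⟩ := h s
      exact hc.not_ge (hs c)
    rw [or_iff_left hnot]
    exact ⟨fun ht c => (Nat.sInf_mem (s := {s | ∀ c, m ≤ copies x s c}) ⟨s, hs⟩ c).trans
      (copies_mono x ht c), fun ht => Nat.sInf_le ht⟩

lemma card_copies_lt_anti {s t k : ℕ} (h : s ≤ t) :
    (Finset.univ.filter fun c => copies x t c < k).card ≤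
      (Finset.univ.filter fun c => copies x s c < k).card :=
  Finset.card_le_card (Finset.monotone_filter_right _ fun c _ => (copies_mono x h c).trans_lt)

lemma card_copies_eq_le_add {s t k : ℕ} (h : s ≤ t) :
    (Finset.univ.filter fun c => copies x t c = k).card ≤
      (Finset.univ.filter fun c => copies x s c = k).card +
        (Finset.univ.filter fun c => copies x s c < k).card := by
  refine (Finset.card_le_card fun c hc => ?_).trans (Finset.card_union_le _ _)
  rw [Finset.mem_filter] at hc
  rw [← Finset.filter_or, Finset.mem_filter]
  exact ⟨hc.1, ((copies_mono x h c).trans_eq hc.2).eq_or_lt⟩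

lemma abs_mul_card_copies_eq_sub_lt {s u t k : ℕ} (hsu : s ≤ u) (hut : u ≤ t)
    {a z zs zt δ : ℝ} (ha : 0 ≤ a) (hzs : zs ≤ z + δ) (hzt : z - δ ≤ zt)
    (hs : |a * (Finset.univ.filter fun c => copies x s c = k).card - zs| < δ)
    (ht : |a * (Finset.univ.filter fun c => copies x t c = k).card - zt| < δ)
    (hrare : a * (Finset.univ.filter fun c => copies x s c < k).card < δ) :
    |a * (Finset.univ.filter fun c => copies x u c = k).card - z| < 3 * δ := by
  have hupper := mul_le_mul_of_nonneg_left
    (Nat.cast_le (α := ℝ).2 (card_copies_eq_le_add (x := x) (k := k) hsu)) ha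
  have hlower := mul_le_mul_of_nonneg_left
    (Nat.cast_le (α := ℝ).2 ((card_copies_eq_le_add (x := x) (k := k) hut).trans
      (Nat.add_le_add_left (card_copies_lt_anti hsu) _))) ha
  push_cast at hupper hlower
  rw [abs_lt] at hs ht ⊢
  constructor <;> linarith

end Deterministic

namespace IsCouponSequence

variable {Ω : Type*} [MeasurableSpace Ω] {P : Measure Ω} {n : ℕ} {draw : ℕ → Ω → Fin n}

lemma measurable_collectionTime (h : IsCouponSequence P draw) (m : ℕ) :
    Measurable fun ω => collectionTime m (draw · ω) := by
  refine measurable_of_Iic fun t => ?_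
  have hpre : (fun ω => collectionTime m (draw · ω)) ⁻¹' Set.Iic t =
      {ω | ∀ c, m ≤ copies (draw · ω) t c} ∪ ⋂ s, {ω | ∃ c, copies (draw · ω) s c < m} := by
    ext ω
    simp only [Set.mem_preimage, Set.mem_Iic, collectionTime_le_iff, Set.mem_union,
      Set.mem_iInter, Set.mem_ofPred_eq]
  rw [hpre]
  exact (h.measurableSet_copies t fun v => ∀ c, m ≤ v c).union
    (.iInter fun s => h.measurableSet_copies s fun v => ∃ c, v c < m)

lemma measurable_numTons (h : IsCouponSequence P draw) (m k : ℕ) :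
    Measurable fun ω => numTons m k (draw · ω) := by
  have hpair : Measurable fun p : ℕ × Ω =>
      (Finset.univ.filter fun c => copies (draw · p.2) p.1 c = k).card :=
    measurable_from_prod_countable_right fun t => h.measurable_card_filter_copies t (· = k)
  have hcomp := hpair.comp ((h.measurable_collectionTime m).prodMk measurable_id)
  unfold numTons
  exact hcomp

end IsCouponSequence

section CompletionTime

/-- The last time whose centred value `centredTime n d` is at most `x`. -/
noncomputable def collectionFloor (n d : ℕ) (x : ℝ) : ℕ :=
  ⌊n * (Real.log n + d * Real.log (Real.log n) + x)⌋₊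

lemma centredTime_le_iff {n d t : ℕ} {x : ℝ} (hn : n ≠ 0)
    (hx : 0 ≤ Real.log n + d * Real.log (Real.log n) + x) :
    centredTime n d t ≤ x ↔ t ≤ collectionFloor n d x := by
  have hn' : (0 : ℝ) < n := mod_cast Nat.pos_of_ne_zero hn
  rw [collectionFloor, Nat.le_floor_iff (by positivity), centredTime, ← div_le_iff₀' hn']
  constructor <;> intro h <;> linarith

lemma sub_one_div_lt_centredTime_collectionFloor {n : ℕ} (hn : n ≠ 0) (d : ℕ) (x : ℝ) :
    x - 1 / n < centredTime n d (collectionFloor n d x) := by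
  have hn' : (0 : ℝ) < n := mod_cast Nat.pos_of_ne_zero hn
  have hfloor := Nat.lt_floor_add_one (n * (Real.log n + d * Real.log (Real.log n) + x))
  rw [← lt_div_iff₀' hn', add_div] at hfloor
  rw [centredTime, collectionFloor]
  linarith

lemma sub_mul_log_sub_div_eq_centredTime {n : ℕ} (hn : n ≠ 0) (d t : ℕ) :
    ((t : ℝ) - n * Real.log n - (((d + 1 : ℕ) : ℝ) - 1) * n * Real.log (Real.log n)) / n =
      centredTime n d t := by
  have hn' : (n : ℝ) ≠ 0 := mod_cast hn
  rw [centredTime]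
  push_cast
  field_simp
  ring

variable {ι : Type*} {l : Filter ι} {n : ι → ℕ}

lemma eventually_nonneg_log_add_log_log_add (hn : Tendsto n l atTop) (d : ℕ) (x : ℝ) :
    ∀ᶠ i in l, 0 ≤ Real.log (n i) + d * Real.log (Real.log (n i)) + x := by
  filter_upwards [(tendsto_log_natCast hn).eventually_ge_atTop (-x),
    (tendsto_log_log_natCast hn).eventually_ge_atTop 0] with i hlog hloglog
  have hmul := mul_nonneg (Nat.cast_nonneg (α := ℝ) d) hloglog
  linarith

lemma isCollectionScale_collectionFloor (hn : Tendsto n l atTop) (d : ℕ) (x : ℝ) :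
    IsCollectionScale l n d (fun i => collectionFloor (n i) d x) x := by
  have hlower : Tendsto (fun i => x - 1 / (n i : ℝ)) l (𝓝 x) := by
    have hinv : Tendsto (fun i => 1 / (n i : ℝ)) l (𝓝 0) :=
      tendsto_const_nhds.div_atTop (tendsto_natCast_atTop_atTop.comp hn)
    simpa only [sub_zero] using tendsto_const_nhds.sub hinv
  refine tendsto_of_tendsto_of_tendsto_of_le_of_le' hlower tendsto_const_nhds ?_ ?_
  · filter_upwards [hn.eventually_ne_atTop 0] with i hni
    exact (sub_one_div_lt_centredTime_collectionFloor hni d x).le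
  · filter_upwards [hn.eventually_ne_atTop 0, eventually_nonneg_log_add_log_log_add hn d x]
      with i hni hnonneg
    exact (centredTime_le_iff hni hnonneg).2 le_rfl

variable {Ω : ι → Type*} [∀ i, MeasurableSpace (Ω i)] {P : ∀ i, Measure (Ω i)}
  [∀ i, IsProbabilityMeasure (P i)] {draw : ∀ i, ℕ → Ω i → Fin (n i)} {d : ℕ}

lemma tendsto_exp_neg_exp_neg_div_atTop (b : ℝ) :
    Tendsto (fun x : ℝ => Real.exp (-(Real.exp (-x) / b))) atTop (𝓝 1) := by
  simpa using ((Real.tendsto_exp_neg_atTop_nhds_zero.div_const b).neg).rexp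

lemma tendsto_measureReal_forall_exists_copies_lt (hn : Tendsto n l atTop)
    (hdraw : ∀ i, IsCouponSequence (P i) (draw i)) (d : ℕ) :
    Tendsto (fun i => (P i).real {ω | ∀ t, ∃ c, copies (draw i · ω) t c < d + 1}) l (𝓝 0) := by
  rw [Metric.tendsto_nhds]
  intro ε hε
  obtain ⟨x, hx⟩ := ((tendsto_exp_neg_exp_neg_div_atTop d !).eventually_const_lt
    (sub_lt_self 1 hε)).exists
  filter_upwards [((isCollectionScale_collectionFloor hn d x).tendsto_measureReal_forall_lt_copies
    hn hdraw).eventually_const_lt hx] with i hi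
  have hcompl := probReal_compl_eq_one_sub (μ := P i)
    ((hdraw i).measurableSet_copies (collectionFloor (n i) d x) fun v => ∀ c, d < v c)
  rw [Real.dist_0_eq_abs, abs_of_nonneg measureReal_nonneg]
  calc (P i).real {ω | ∀ t, ∃ c, copies (draw i · ω) t c < d + 1} ≤
        (P i).real {ω | ∀ c, d < copies (draw i · ω) (collectionFloor (n i) d x) c}ᶜ := by
        refine measureReal_mono fun ω hω hcomplete => ?_
        obtain ⟨c, hc⟩ := hω (collectionFloor (n i) d x)
        exact hc.not_ge (hcomplete c)
    _ < ε := by rw [hcompl]; linarith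

lemma tendsto_measureReal_centredTime_collectionTime_le (hn : Tendsto n l atTop)
    (hdraw : ∀ i, IsCouponSequence (P i) (draw i)) (d : ℕ) (x : ℝ) :
    Tendsto (fun i => (P i).real
      {ω | centredTime (n i) d (collectionTime (d + 1) (draw i · ω)) ≤ x}) l
      (𝓝 (Real.exp (-(Real.exp (-x) / d !)))) := by
  have hcomplete := (isCollectionScale_collectionFloor hn d x).tendsto_measureReal_forall_lt_copies
    hn hdraw
  have hadd := hcomplete.add (tendsto_measureReal_forall_exists_copies_lt hn hdraw d)
  rw [add_zero] at hadd
  refine tendsto_of_tendsto_of_tendsto_of_le_of_le' hcomplete hadd ?_ ?_ <;>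
    filter_upwards [hn.eventually_ne_atTop 0, eventually_nonneg_log_add_log_log_add hn d x]
      with i hni hnonneg <;>
    simp only [centredTime_le_iff hni hnonneg, collectionTime_le_iff, Nat.succ_le_iff]
  · exact measureReal_mono fun ω => Or.inl
  · exact measureReal_union_le _ _

variable {Ω' : Type*} [MeasurableSpace Ω'] {P' : Measure Ω'} {X : Ω' → ℝ}

lemma IsGumbel.measureReal_le {b : ℝ} (hX : IsGumbel P' X (-Real.log b) 1) (hb : 0 < b) (x : ℝ) :
    P'.real {ω | X ω ≤ x} = Real.exp (-(Real.exp (-x) / b)) := by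
  rw [hX.2, div_one, sub_neg_eq_add, neg_add, ← sub_eq_add_neg, Real.exp_sub, Real.exp_log hb]

variable [IsProbabilityMeasure P'] [l.IsCountablyGenerated]

lemma tendstoInDistribution_centredTime_collectionTime (hn : Tendsto n l atTop)
    (hdraw : ∀ i, IsCouponSequence (P i) (draw i)) (hX : IsGumbel P' X (-Real.log d !) 1) :
    TendstoInDistribution
      (fun i ω => centredTime (n i) d (collectionTime (d + 1) (draw i · ω))) l X P P' := by
  refine tendstoInDistribution_of_tendsto_measureReal_le (fun i =>
    ((measurable_of_countable (centredTime (n i) d)).comp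
      ((hdraw i).measurable_collectionTime (d + 1))).aemeasurable) hX.1 fun x => ?_
  rw [hX.measureReal_le (by positivity)]
  exact tendsto_measureReal_centredTime_collectionTime_le hn hdraw d x

end CompletionTime

section Tons

variable {ι : Type*} {l : Filter ι} {n : ι → ℕ} {Ω : ι → Type*} [∀ i, MeasurableSpace (Ω i)]
  {P : ∀ i, Measure (Ω i)} [∀ i, IsProbabilityMeasure (P i)] {draw : ∀ i, ℕ → Ω i → Fin (n i)}
  {d : ℕ} {k : ι → ℕ}

lemma isSmallMultiplicity_of_isLittleO (hn : Tendsto n l atTop)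
    (hzero : d = 0 → (fun i => (k i : ℝ)) =o[l] fun i => Real.log (n i))
    (hpos : 0 < d → (fun i => (k i : ℝ)) =o[l] fun i =>
      Real.log (n i) / Real.log (Real.log (n i))) :
    IsSmallMultiplicity l n d k := by
  rcases Nat.eq_zero_or_pos d with rfl | hd
  · simpa [IsSmallMultiplicity] using (hzero rfl).tendsto_div_nhds_zero
  · have hfactor : (fun i => 1 + d * Real.log (Real.log (n i))) =O[l]
        fun i => Real.log (Real.log (n i)) :=
      ((isLittleO_const_left.2 (.inr (tendsto_norm_atTop_atTop.comp
        (tendsto_log_log_natCast hn)))).isBigO).add ((isBigO_refl _ l).const_mul_left _)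
    refine IsLittleO.tendsto_div_nhds_zero (((hpos hd).mul_isBigO hfactor).congr' .rfl ?_)
    filter_upwards [(tendsto_log_log_natCast hn).eventually_ne_atTop 0] with i hi
    exact div_mul_cancel₀ _ hi

lemma exists_pos_exp_neg_sub_le (y : ℝ) {δ : ℝ} (hδ : 0 < δ) :
    ∃ h > 0, Real.exp (-(y - h)) - Real.exp (-(y + h)) ≤ δ := by
  have hcont : Continuous fun h : ℝ => Real.exp (-(y - h)) - Real.exp (-(y + h)) := by fun_prop
  have hlim : Tendsto (fun h : ℝ => Real.exp (-(y - h)) - Real.exp (-(y + h))) (𝓝[>] 0) (𝓝 0) := by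
    simpa using (hcont.tendsto 0).mono_left nhdsWithin_le_nhds
  exact (eventually_mem_nhdsWithin.and (hlim.eventually_le_const hδ)).exists

lemma tendsto_measureReal_numTons_inter_centredTime_mem_Ioc (hn : Tendsto n l atTop)
    (hdraw : ∀ i, IsCouponSequence (P i) (draw i)) (hk : IsSmallMultiplicity l n d k)
    (hdk : ∀ᶠ i in l, d < k i) {a b δ : ℝ} (hab : Real.exp (-a) - Real.exp (-b) ≤ δ) (hδ : 0 < δ) :
    Tendsto (fun i => (P i).real ({ω | 3 * δ ≤ |tonScale (n i) d (k i) *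
      numTons (d + 1) (k i) (draw i · ω) -
        Real.exp (-centredTime (n i) d (collectionTime (d + 1) (draw i · ω)))|} ∩
      (fun ω => centredTime (n i) d (collectionTime (d + 1) (draw i · ω))) ⁻¹' Set.Ioc a b)) l
      (𝓝 0) := by
  have hfa := isCollectionScale_collectionFloor hn d a
  have hfb := isCollectionScale_collectionFloor hn d b
  have hsum := ((hfa.tendsto_measureReal_le_abs_tons_sub hn hdraw hk hdk hδ).add
    (hfb.tendsto_measureReal_le_abs_tons_sub hn hdraw hk hdk hδ)).add
    (hfa.tendsto_measureReal_le_tonScale_mul_copies_lt hn hdraw hk hdk hδ)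
  rw [add_zero, add_zero] at hsum
  refine squeeze_zero' (.of_forall fun i => measureReal_nonneg) ?_ hsum
  filter_upwards [hn.eventually_ne_atTop 0, eventually_nonneg_log_add_log_log_add hn d a,
    eventually_nonneg_log_add_log_log_add hn d b] with i hni ha hb
  refine (measureReal_mono ?_).trans ((measureReal_union_le _ _).trans
    (add_le_add_left (measureReal_union_le _ _) _))
  rintro ω ⟨hfar, hYa, hYb⟩
  by_contra hgood
  simp only [Set.mem_union, Set.mem_ofPred_eq, not_or, not_le] at hgood
  obtain ⟨⟨hga, hgb⟩, hrare⟩ := hgood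
  have hTa := (not_le.1 (mt (centredTime_le_iff hni ha).2 hYa.not_ge)).le
  have hTb := (centredTime_le_iff hni hb).1 hYb
  have hexpa := Real.exp_le_exp.2 (neg_le_neg hYa.le)
  have hexpb := Real.exp_le_exp.2 (neg_le_neg hYb)
  exact hfar.not_gt (abs_mul_card_copies_eq_sub_lt hTa hTb (tonScale_nonneg _ _ _)
    (by linarith) (by linarith) hga hgb hrare)

variable {Ω' : Type*} [MeasurableSpace Ω'] {P' : Measure Ω'} [IsProbabilityMeasure P']
  {X : Ω' → ℝ} [l.IsCountablyGenerated]

lemma tendsto_measureReal_le_abs_tonScale_mul_numTons_sub (hn : Tendsto n l atTop)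
    (hdraw : ∀ i, IsCouponSequence (P i) (draw i)) (hk : IsSmallMultiplicity l n d k)
    (hdk : ∀ᶠ i in l, d < k i) (hX : IsGumbel P' X (-Real.log d !) 1) {ε : ℝ} (hε : 0 < ε) :
    Tendsto (fun i => (P i).real {ω | ε ≤ |tonScale (n i) d (k i) *
      numTons (d + 1) (k i) (draw i · ω) -
        Real.exp (-centredTime (n i) d (collectionTime (d + 1) (draw i · ω)))|}) l (𝓝 0) := by
  refine tendsto_measureReal_of_forall_exists_nhds
    (tendstoInDistribution_centredTime_collectionTime hn hdraw hX) fun y => ?_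
  obtain ⟨h, hh, hexp⟩ := exists_pos_exp_neg_sub_le y (by positivity : 0 < ε / 3)
  refine ⟨Set.Ioc (y - h) (y + h), Ioc_mem_nhds (sub_lt_self y hh) (lt_add_of_pos_right y hh), ?_⟩
  simpa only [mul_div_cancel₀ ε three_ne_zero] using
    tendsto_measureReal_numTons_inter_centredTime_mem_Ioc hn hdraw hk hdk hexp (by positivity)

end Tons

theorem theorem1_general {ι : Type*} {l : Filter ι} [l.IsCountablyGenerated] {n : ι → ℕ}
    (hn : Tendsto n l atTop) (m : ℕ) (hm : 1 ≤ m) {Ω : ι → Type*} [∀ i, MeasurableSpace (Ω i)]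
    (P : (i : ι) → Measure (Ω i)) [∀ i, IsProbabilityMeasure (P i)]
    (draw : (i : ι) → ℕ → Ω i → Fin (n i)) (hdraw : ∀ i, IsCouponSequence (P i) (draw i))
    (k : ι → ℕ) (hmk : ∀ᶠ i in l, m ≤ k i)
    (hk_one : m = 1 → (fun i => (k i : ℝ)) =o[l] fun i => Real.log (n i))
    (hk_two : 2 ≤ m →
      (fun i => (k i : ℝ)) =o[l] fun i => Real.log (n i) / Real.log (Real.log (n i)))
    {Ω' : Type*} [MeasurableSpace Ω'] (P' : Measure Ω') [IsProbabilityMeasure P']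
    (X : Ω' → ℝ) (hX : IsGumbel P' X (-Real.log ((m - 1)! : ℝ)) 1) :
    TendstoInDistribution
      (fun i ω =>
        (((collectionTime m (draw i · ω) : ℝ) - n i * Real.log (n i)
            - ((m : ℝ) - 1) * n i * Real.log (Real.log (n i))) / n i,
          ((k i)! : ℝ) * numTons m (k i) (draw i · ω) / Real.log (n i) ^ (k i - m + 1)))
      l (fun ω' => (X ω', Real.exp (-X ω'))) P P' := by
  obtain ⟨d, rfl⟩ : ∃ d, m = d + 1 := Nat.exists_eq_add_of_le' hm
  have hk : IsSmallMultiplicity l n d k :=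
    isSmallMultiplicity_of_isLittleO hn (fun hd => hk_one (by omega)) fun hd => hk_two (by omega)
  have hX : IsGumbel P' X (-Real.log d !) 1 := hX
  have hpair := (tendstoInDistribution_centredTime_collectionTime hn hdraw hX).continuous_comp
    (g := fun y : ℝ => (y, Real.exp (-y))) (by fun_prop)
  refine tendstoInDistribution_of_tendsto_measureReal_sub hpair (fun ε hε => ?_) fun i => ?_
  · refine (tendsto_measureReal_le_abs_tonScale_mul_numTons_sub hn hdraw hk hmk hX hε).congr' ?_
    filter_upwards [hmk, hn.eventually_ne_atTop 0] with i hdk hni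
    have hexponent : k i - (d + 1) + 1 = k i - d := by omega
    simp only [sub_mul_log_sub_div_eq_centredTime hni]
    simp [Prod.norm_def, tonScale, hexponent, div_mul_eq_mul_div]
  · have hT := (hdraw i).measurable_collectionTime (d + 1)
    have hS := (hdraw i).measurable_numTons (d + 1) (k i)
    fun_prop

theorem theorem1 (m : ℕ) (hm : 1 ≤ m)
    {Ω : ℕ+ → Type*} [∀ n, MeasurableSpace (Ω n)]
    (P : (n : ℕ+) → Measure (Ω n)) [∀ n, IsProbabilityMeasure (P n)]
    (draw : (n : ℕ+) → ℕ → Ω n → Fin n) (hdraw : ∀ n, IsCouponSequence (P n) (draw n))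
    (k : ℕ+ → ℕ) (hmk : ∀ᶠ n in atTop, m ≤ k n)
    (hk_one : m = 1 →
      (fun n => (k n : ℝ)) =o[atTop] fun n : ℕ+ => Real.log n)
    (hk_two : 2 ≤ m →
      (fun n => (k n : ℝ)) =o[atTop] fun n : ℕ+ => Real.log n / Real.log (Real.log n))
    {Ω' : Type*} [MeasurableSpace Ω'] (P' : Measure Ω') [IsProbabilityMeasure P']
    (X : Ω' → ℝ) (hX : IsGumbel P' X (-Real.log ((m - 1).factorial : ℝ)) 1) :
    TendstoInDistribution
      (fun (n : ℕ+) (ω : Ω n) =>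
        ((((collectionTime m (fun i => draw n i ω) : ℕ) : ℝ) - (n : ℝ) * Real.log n
            - ((m : ℝ) - 1) * (n : ℝ) * Real.log (Real.log n)) / (n : ℝ),
          ((k n).factorial : ℝ) * ((numTons m (k n) (fun i => draw n i ω) : ℕ) : ℝ)
            / Real.log n ^ (k n - m + 1)))
      atTop
      (fun ω' => (X ω', Real.exp (-X ω')))
      P P' := by
  exact theorem1_general tendsto_PNat_val_atTop_atTop m hm P draw hdraw k hmk hk_one hk_two P' X hX
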